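/- Let $\widetilde Q$ be a finite acyclic quiver with vertex set $V$ and a set $C\subseteq V$ of frozen vertices, and let $Q$ be the full subquiver on $V\setminus C$. Assume that $Q$ is tame, i.e. that its underlying diagram is an extended Dynkin diagram $\widetilde A_n$ $(n\ge 1)$, $\widetilde D_n$ $(n\ge4)$, $\widetilde E_6$, $\widetilde E_7$ or $\widetilde E_8$, and let $\delta$ be the minimal imaginary root of $Q$. Let $k$ be a finite field, $q=|k|$. Modules are finite-dimensional modules over the path algebra, with the convention that $\dim\mathrm{Ext}^1(S_i,S_j)$ is the number of arrows $j\to i$ (a module is a family of spaces $M_i$ with a map $M_j\to M_i$ for each arrow $i\to j$). An indecomposable $kQ$-module $M$ is preprojective if $\tau^mM=0$ for some $m$, and preinjective if $\tau^{-m}M=0$ for some $m$; a module is regular if none of its indecomposable summands is preprojective or preinjective; a regular simple module is an indecomposable regular module whose only regular submodules are $0$ and itself. Let $E$ and $E'$ be two regular simple $kQ$-modules of dimension vector $\delta$ (such modules lie in homogeneous tubes). Then $$|\mathrm{Gr}_{\underline e}(E)|=|\mathrm{Gr}_{\underline e}(E')|\quad\text{for every dimension vector }\underline e,$$ where $\mathrm{Gr}_{\underline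 e}(M)$ is the set of submodules of $M$ of dimension vector $\underline e$. Moreover, let $\widetilde B$ and $\widetilde R$ be the $V\times(V\setminus C)$ matrices with entries $b_{ij}=|\{i\to j\}|-|\{j\to i\}|$ and $\widetilde r_{ij}=\dim\mathrm{Ext}^1(S_i,S_j)$, let $\widetilde I$ consist of the columns of the $V\times V$ identity matrix indexed by $V\setminus C$, and let $\Lambda$ be any antisymmetric integral $V\times V$ matrix with $\Lambda(-\widetilde B)=\widetilde I$. Let $\mathcal T_{|k|}$ be the based quantum torus with $\mathbb Z[q^{\pm1/2}]$-basis $\{X^{c}: c\in\mathbb Z^V\}$ and multiplication $X^cX^d=q^{\frac12 c^{t}\Lambda d}X^{c+d}$, and for a $kQ$-module $M$ of dimension vector $\underline m$ put $$X_M=\sum_{\underline e}|\mathrm{Gr}_{\underline e}(M)|\,q^{-\frac12\langle\underline e,\underline m-\underline e\rangle}X^{\widetilde B\underline e-(\widetilde I-\widetilde R)\underline m},$$ where $\langle\ ,\ \rangle$ is the Euler form of $Q$. Then $X_E=X_{E'}$ in $\mathcal T_{|k|}$. The same equality holds in the quantum torus over $\mathbb Z[q^{\pm1/2}]$ when $q^{1/2}$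 is a formal variable. -/

import Mathlib

open scoped Matrix

universe u

namespace TameQuiver

/-! ### Quivers -/

section Quivers

variable (V : Type) [Quiver.{0} V]

/-- A quiver is acyclic if it has no oriented cycle of positive length. -/
def IsAcyclic : Prop := ∀ (v : V) (p : Quiver.Path v v), p.length = 0

/-- Names of the (simply laced) extended Dynkin diagrams:
`A n` is `Ã_{n+1}`, `D n` is `D̃_{n+4}`, and `E6, E7, E8` are `Ẽ₆, Ẽ₇, Ẽ₈`. -/
inductive ExtendedDynkin : Type
  | A (n : ℕ)
  | D (n : ℕ)
  | E6
  | E7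
  | E8

/-- The number of vertices of an extended Dynkin diagram; its vertices are `0, 1, 2, …`. -/
def ExtendedDynkin.size : ExtendedDynkin → ℕ
  | .A n => n + 2
  | .D n => n + 5
  | .E6 => 7
  | .E7 => 8
  | .E8 => 9

/-- The edges of an extended Dynkin diagram: a cycle for `Ã` (a double edge for `Ã₁`), a path with
two extra leaves at each of its ends for `D̃`, and stars with arms of lengths `2, 2, 2`, `1, 3, 3`
and `1, 2, 5` for `Ẽ₆`, `Ẽ₇` and `Ẽ₈`. -/
def ExtendedDynkin.edges : ExtendedDynkin → List (ℕ × ℕ)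
  | .A n => (List.range (n + 1)).map (fun i => (i, i + 1)) ++ [(n + 1, 0)]
  | .D n => [(0, 2), (1, 2)] ++ (List.range n).map (fun i => (i + 2, i + 3)) ++
      [(n + 2, n + 3), (n + 2, n + 4)]
  | .E6 => [(0, 1), (1, 2), (0, 3), (3, 4), (0, 5), (5, 6)]
  | .E7 => [(0, 1), (0, 2), (2, 3), (3, 4), (0, 5), (5, 6), (6, 7)]
  | .E8 => [(0, 1), (0, 2), (2, 3), (0, 4), (4, 5), (5, 6), (6, 7), (7, 8)]

/-- The number of edges joining two vertices of an extended Dynkin diagram. -/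
def ExtendedDynkin.edgeCount (D : ExtendedDynkin) (i j : ℕ) : ℕ :=
  D.edges.countP (fun e => decide (e = (i, j) ∨ e = (j, i)))

/-- A tame quiver: an acyclic quiver whose underlying diagram is an extended Dynkin diagram. -/
def IsTame : Prop :=
  IsAcyclic V ∧ (∀ i j : V, Finite (i ⟶ j)) ∧
    ∃ (D : ExtendedDynkin) (f : V ≃ Fin D.size), ∀ i j : V,
      Nat.card (i ⟶ j) + Nat.card (j ⟶ i) = D.edgeCount (f i) (f j)

variable {V}

/-- The vertices of a quiver that are not in the set `C` of frozen vertices. -/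
abbrev Principal (C : Finset V) : Type := {v : V // v ∉ C}

/-- The principal part of an ice quiver: the full subquiver on the vertices that are not frozen. -/
instance principalQuiver (C : Finset V) : Quiver.{0} (Principal C) := ⟨fun i j => i.1 ⟶ j.1⟩

/-- The matrix with entries `r_{ij} = dim Ext¹(S_i, S_j)`, which is the number of arrows `j ⟶ i`
(see `Rep.finrank_ext1_simple`). -/
noncomputable def extMatrix (V : Type) [Quiver.{0} V] : Matrix V V ℤ := fun i j => (Nat.card (j ⟶ i) : ℤ)

/-- The Euler form `⟨e, f⟩ = eᵗ (1 - R) f` on (integral) dimension vectors; it is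
`dim Hom(M, N) - dim Ext¹(M, N)` for modules `M`, `N` of dimension vectors `e`, `f`
(see `Rep.euler_form_eq`). -/
noncomputable def eulerForm [Fintype V] (e f : V → ℤ) : ℤ := e ⬝ᵥ f - e ⬝ᵥ (extMatrix V *ᵥ f)

/-- `δ` is the minimal imaginary root: the least nonzero vector with nonnegative integral entries at
which the quadratic form `⟨x, x⟩` vanishes. -/
def IsMinimalImaginaryRoot [Fintype V] (δ : V → ℕ) : Prop :=
  IsLeast {x : V → ℕ | x ≠ 0 ∧ eulerForm (fun i => (x i : ℤ)) (fun i => (x i : ℤ)) = 0} δ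

end Quivers

/-! ### Modules over the path algebra -/

/-- A module over the path algebra, as a family of vector spaces indexed by the vertices, with
a linear map `M_j → M_i` for every arrow `i ⟶ j` (right modules if paths are composed from right
to left). With this convention `dim Ext¹(S_i, S_j)` is the number of arrows `j ⟶ i`. -/
structure Rep (k : Type u) [Field k] (V : Type) [Quiver.{0} V] where
  obj : V → Type u
  [addCommGroup : ∀ i, AddCommGroup (obj i)]
  [module : ∀ i, Module k (obj i)]
  map : ∀ {i j : V}, (i ⟶ j) → (obj j →ₗ[k] obj i)

attribute [instance] Rep.addCommGroup Rep.module

namespace Rep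

variable {k : Type u} [Field k] {V : Type} [Quiver.{0} V]

/-- `M` is finite-dimensional with dimension vector `d`. -/
def HasDimVector (M : Rep k V) (d : V → ℕ) : Prop :=
  ∀ i, Module.Finite k (M.obj i) ∧ Module.finrank k (M.obj i) = d i

/-- The dimension vector. -/
noncomputable def dimVector (M : Rep k V) : V → ℕ := fun i => Module.finrank k (M.obj i)

/-- The zero module. -/
def IsZero (M : Rep k V) : Prop := ∀ i, Subsingleton (M.obj i)

/-- Homomorphisms of modules. -/
@[ext]
structure Hom (M N : Rep k V) where
  app : ∀ i, M.obj i →ₗ[k] N.obj i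
  comm : ∀ {i j : V} (a : i ⟶ j), app i ∘ₗ M.map a = N.map a ∘ₗ app j

/-- Submodules. -/
structure Sub (M : Rep k V) where
  carrier : ∀ i, Submodule k (M.obj i)
  map_mem : ∀ {i j : V} (a : i ⟶ j) (x : M.obj j), x ∈ carrier j → M.map a x ∈ carrier i

/-- A submodule as a module. -/
def Sub.toRep {M : Rep k V} (U : Sub M) : Rep k V where
  obj i := U.carrier i
  map a := (M.map a).restrict (U.map_mem a)

/-- The quiver Grassmannian of submodules of dimension vector `e`. -/
def Gr (M : Rep k V) (e : V → ℕ) : Type u := {U : Sub M // U.toRep.HasDimVector e}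

/-- Indecomposable: nonzero, and not a direct sum of two nonzero submodules. -/
def IsIndecomposable (M : Rep k V) : Prop :=
  ¬ M.IsZero ∧ ∀ U W : Sub M, IsCompl U.carrier W.carrier → U.carrier = ⊥ ∨ W.carrier = ⊥

/-! #### Extensions -/

/-- The map `⨁_i Hom(M_i, N_i) → ⨁_{a : i ⟶ j} Hom(M_j, N_i)`, whose kernel is `Hom(M, N)`
and whose cokernel is `Ext¹(M, N)`. -/
def extDiff (M N : Rep k V) :
    (∀ i, M.obj i →ₗ[k] N.obj i) →ₗ[k] (∀ i j : V, (i ⟶ j) → (M.obj j →ₗ[k] N.obj i)) where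
  toFun f := fun i j a => f i ∘ₗ M.map a - N.map a ∘ₗ f j
  map_add' f g := by
    funext i j a; ext x; simp; abel
  map_smul' c f := by
    funext i j a; ext x; simp [smul_sub]

/-- `Ext¹(M, N)`. -/
abbrev Ext1 (M N : Rep k V) : Type u :=
  (∀ i j : V, (i ⟶ j) → (M.obj j →ₗ[k] N.obj i)) ⧸ LinearMap.range (extDiff M N)

/-- `Ext¹(M, φ)`. -/
def ext1Post (M : Rep k V) {N N' : Rep k V} (φ : Hom N N') : Ext1 M N →ₗ[k] Ext1 M N' :=
  Submodule.mapQ _ _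
    ({ toFun := fun c i j a => φ.app i ∘ₗ c i j a
       map_add' := fun c d => by funext i j a; ext x; simp
       map_smul' := fun r c => by funext i j a; ext x; simp } :
      (∀ i j : V, (i ⟶ j) → (M.obj j →ₗ[k] N.obj i)) →ₗ[k]
        (∀ i j : V, (i ⟶ j) → (M.obj j →ₗ[k] N'.obj i)))
    (by
      rintro _ ⟨f, rfl⟩
      refine ⟨fun i => φ.app i ∘ₗ f i, ?_⟩
      funext i j a
      ext x
      have h := LinearMap.congr_fun (φ.comm a) (f j x)
      simp only [LinearMap.comp_apply] at h
      simp [extDiff, h])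

/-- `Ext¹(φ, N)`. -/
def ext1Pre {M M' : Rep k V} (φ : Hom M M') (N : Rep k V) : Ext1 M' N →ₗ[k] Ext1 M N :=
  Submodule.mapQ _ _
    ({ toFun := fun c i j a => c i j a ∘ₗ φ.app j
       map_add' := fun c d => by funext i j a; ext x; simp
       map_smul' := fun r c => by funext i j a; ext x; simp } :
      (∀ i j : V, (i ⟶ j) → (M'.obj j →ₗ[k] N.obj i)) →ₗ[k]
        (∀ i j : V, (i ⟶ j) → (M.obj j →ₗ[k] N.obj i)))
    (by
      rintro _ ⟨f, rfl⟩
      refine ⟨fun i => f i ∘ₗ φ.app i, ?_⟩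
      funext i j a
      ext x
      have h := LinearMap.congr_fun (φ.comm a) x
      simp only [LinearMap.comp_apply] at h
      simp [extDiff, h])

/-! #### Simple, projective and injective modules -/

variable (k)

/-- The simple module `S_v`: the field at the vertex `v` and zero elsewhere. -/
def simple (v : V) : Rep k V where
  obj i := PLift (i = v) → k
  map _ := 0

/-- The indecomposable projective module `P_v`, with basis the paths ending at `v`. -/
noncomputable def proj (v : V) : Rep k V where
  obj i := Quiver.Path i v →₀ k
  map a := Finsupp.lmapDomain k k (fun p => a.toPath.comp p)

/-- The indecomposable injective module `I_v`, dual to the space of paths starting at `v`. -/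
def inj (v : V) : Rep k V where
  obj i := Quiver.Path v i → k
  map a := LinearMap.funLeft k k (fun p => p.cons a)

/-- The homomorphism `P_v → P_w` given by an arrow `v ⟶ w`. -/
noncomputable def projMap {v w : V} (b : v ⟶ w) : Hom (proj k v) (proj k w) where
  app _ := Finsupp.lmapDomain k k (fun p => p.cons b)
  comm a := by
    refine Finsupp.lhom_ext fun p c => ?_
    change Finsupp.mapDomain _ (Finsupp.mapDomain _ (Finsupp.single p c)) =
      Finsupp.mapDomain _ (Finsupp.mapDomain _ (Finsupp.single p c))
    rw [Finsupp.mapDomain_single, Finsupp.mapDomain_single, Finsupp.mapDomain_single,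
      Finsupp.mapDomain_single]
    rfl

/-- The homomorphism `I_v → I_w` given by an arrow `v ⟶ w`. -/
def injMap {v w : V} (b : v ⟶ w) : Hom (inj k v) (inj k w) where
  app _ := LinearMap.funLeft k k (fun p => b.toPath.comp p)
  comm a := by
    ext f
    rfl

variable {k}

/-! #### The Auslander–Reiten translation and regular modules -/

/-- The Auslander–Reiten translate `τ M = D Ext¹(M, kQ)`, with `(τ M)_v = D Ext¹(M, P_v)`. -/
noncomputable def tau (M : Rep k V) : Rep k V where
  obj v := Module.Dual k (Ext1 M (proj k v))
  map b := (ext1Post M (projMap k b)).dualMap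

/-- The inverse translate `τ⁻ M = Ext¹(D(kQ), M)`, with `(τ⁻ M)_v = Ext¹(I_v, M)`. -/
def tauInv (M : Rep k V) : Rep k V where
  obj v := Ext1 (inj k v) M
  map b := ext1Pre (injMap k b) M

/-- An indecomposable module is preprojective if some power of `τ` annihilates it. -/
def IsPreprojectiveIndec (M : Rep k V) : Prop :=
  M.IsIndecomposable ∧ ∃ m : ℕ, (tau^[m] M).IsZero

/-- An indecomposable module is preinjective if some power of `τ⁻` annihilates it. -/
def IsPreinjectiveIndec (M : Rep k V) : Prop :=
  M.IsIndecomposable ∧ ∃ m : ℕ, (tauInv^[m] M).IsZero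

/-- A regular module: every indecomposable direct summand is neither preprojective nor
preinjective. -/
def IsRegular (M : Rep k V) : Prop :=
  ∀ U W : Sub M, IsCompl U.carrier W.carrier → U.toRep.IsIndecomposable →
    ¬ U.toRep.IsPreprojectiveIndec ∧ ¬ U.toRep.IsPreinjectiveIndec

/-- A regular simple module: an indecomposable regular module without regular submodules other than
zero and the whole module. -/
def IsRegularSimple (M : Rep k V) : Prop :=
  M.IsIndecomposable ∧ M.IsRegular ∧
    ∀ U : Sub M, U.toRep.IsRegular → U.carrier = ⊥ ∨ U.carrier = ⊤

/-! #### Dimensions of `Hom` and `Ext¹` -/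

theorem euler_form_eq [Fintype V] [∀ i j : V, Finite (i ⟶ j)] {M N : Rep k V} {m n : V → ℕ}
    (hM : M.HasDimVector m) (hN : N.HasDimVector n) :
    (Module.finrank k (LinearMap.ker (extDiff M N)) : ℤ) - Module.finrank k (Ext1 M N) =
      eulerForm (fun i => (m i : ℤ)) (fun i => (n i : ℤ)) := by
  classical
  have := fun i => (hM i).1
  have := fun i => (hN i).1
  have := fun i j : V => Fintype.ofFinite (i ⟶ j)
  have h1 := LinearMap.finrank_range_add_finrank_ker (extDiff M N)
  have h2 := Submodule.finrank_quotient_add_finrank (LinearMap.range (extDiff M N))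
  have h3 : Module.finrank k (∀ i, M.obj i →ₗ[k] N.obj i) = ∑ i, m i * n i := by
    rw [Module.finrank_pi_fintype]
    exact Finset.sum_congr rfl fun i _ => by
      rw [Module.finrank_linearMap, (hM i).2, (hN i).2]
  have h4 : Module.finrank k (∀ i j : V, (i ⟶ j) → (M.obj j →ₗ[k] N.obj i)) =
      ∑ i, ∑ j, Nat.card (i ⟶ j) * (m j * n i) := by
    rw [Module.finrank_pi_fintype]
    refine Finset.sum_congr rfl fun i _ => ?_
    rw [Module.finrank_pi_fintype]
    refine Finset.sum_congr rfl fun j _ => ?_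
    rw [Module.finrank_pi_fintype]
    simp [Module.finrank_linearMap, (hM j).2, (hN i).2]
  have h5 : eulerForm (fun i => (m i : ℤ)) (fun i => (n i : ℤ)) =
      ((∑ i, m i * n i : ℕ) : ℤ) - ((∑ i, ∑ j, Nat.card (i ⟶ j) * (m j * n i) : ℕ) : ℤ) := by
    simp only [eulerForm, dotProduct, Matrix.mulVec, extMatrix]
    push_cast
    congr 1
    rw [Finset.sum_comm]
    refine Finset.sum_congr rfl fun i _ => ?_
    rw [Finset.mul_sum]
    exact Finset.sum_congr rfl fun j _ => by ring
  rw [h5, ← h3, ← h4, ← h1, ← h2]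
  push_cast
  ring

theorem finrank_ext1_simple [Fintype V] [∀ i j : V, Finite (i ⟶ j)] (i j : V) :
    (Module.finrank k (Ext1 (simple k i) (simple k j)) : ℤ) = extMatrix V i j := by
  classical
  have := fun i j : V => Fintype.ofFinite (i ⟶ j)
  have h0 : extDiff (simple k i) (simple k j) = 0 := by
    refine LinearMap.ext fun f => ?_
    funext x y a
    change f x ∘ₗ (0 : _ →ₗ[k] _) - (0 : _ →ₗ[k] _) ∘ₗ f y = 0
    simp
  have hd : ∀ x v : V, Module.finrank k ((simple k v).obj x) = if x = v then 1 else 0 := by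
    intro x v
    change Module.finrank k (PLift (x = v) → k) = _
    rw [Module.finrank_fintype_fun_eq_card]
    split_ifs with h <;> simp [h]
  have hf : ∀ x v : V, Module.Finite k ((simple k v).obj x) := fun x v =>
    inferInstanceAs (Module.Finite k (PLift (x = v) → k))
  have h2 := Submodule.finrank_quotient_add_finrank
    (LinearMap.range (extDiff (simple k i) (simple k j)))
  have h3 : Module.finrank k (LinearMap.range (extDiff (simple k i) (simple k j))) = 0 := by
    rw [h0, LinearMap.range_zero, finrank_bot]
  rw [h3, add_zero] at h2
  rw [h2, Module.finrank_pi_fintype]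
  simp_rw [Module.finrank_pi_fintype, Module.finrank_linearMap, hd]
  simp [extMatrix]

end Rep

/-! ### The quantum torus -/

/-- The based quantum torus of the form `Λ(e, f) = eᵗ Λ f` on the lattice `ℤ^V`, over a commutative
ring `R` with a distinguished unit `h`, in the role of `q^{1/2}`. It is the free `R`-module
on the monomials `X^e`, with `X^e X^f = h^{Λ(e, f)} X^{e + f}`. -/
def Torus {V : Type} {R : Type*} [CommRing R] (_h : Rˣ) (_Λ : Matrix V V ℤ) : Type _ :=
  (V → ℤ) →₀ R

namespace Torus

variable {V : Type} {R : Type*} [CommRing R] (h : Rˣ) (Λ : Matrix V V ℤ)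

noncomputable instance : AddCommGroup (Torus h Λ) := inferInstanceAs (AddCommGroup ((V → ℤ) →₀ R))
noncomputable instance : Module R (Torus h Λ) := inferInstanceAs (Module R ((V → ℤ) →₀ R))

/-- The term `r X^e`. -/
noncomputable def term (e : V → ℤ) (r : R) : Torus h Λ := Finsupp.single e r

/-- The basis element `X^e`. -/
noncomputable def monomial (e : V → ℤ) : Torus h Λ := term h Λ e 1

theorem induction_on {p : Torus h Λ → Prop} (x : Torus h Λ) (h0 : p 0)
    (hadd : ∀ x y, p x → p y → p (x + y)) (hterm : ∀ e r, p (term h Λ e r)) : p x :=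
  Finsupp.induction_linear (motive := p) x h0 (fun x y => hadd x y) hterm

variable [Fintype V]

/-- The form `Λ(e, f) = eᵗ Λ f`. -/
def form (e f : V → ℤ) : ℤ := e ⬝ᵥ (Λ *ᵥ f)

/-- The biadditive multiplication `(r X^e) (s X^f) = h^{Λ(e, f)} r s X^{e + f}`. -/
noncomputable def mulHom : ((V → ℤ) →₀ R) →+ ((V → ℤ) →₀ R) →+ ((V → ℤ) →₀ R) :=
  Finsupp.liftAddHom fun e =>
    { toFun := fun r => Finsupp.liftAddHom fun f =>
        (Finsupp.singleAddHom (e + f)).comp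
          (AddMonoidHom.mulLeft (((h ^ form Λ e f : Rˣ) : R) * r))
      map_zero' := by ext; simp
      map_add' := fun r s => by
        ext f t : 2
        simp [mul_add, add_mul] }

noncomputable instance : Mul (Torus h Λ) := ⟨fun x y => mulHom h Λ x y⟩

noncomputable instance : One (Torus h Λ) := ⟨monomial h Λ 0⟩

theorem term_mul_term (e f : V → ℤ) (r s : R) :
    term h Λ e r * term h Λ f s =
      term h Λ (e + f) (((h ^ form Λ e f : Rˣ) : R) * r * s) := by
  change mulHom h Λ (Finsupp.single e r) (Finsupp.single f s) = Finsupp.single _ _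
  simp [mulHom]

theorem monomial_mul_monomial (e f : V → ℤ) :
    monomial h Λ e * monomial h Λ f =
      ((h ^ form Λ e f : Rˣ) : R) • monomial h Λ (e + f) := by
  rw [monomial, monomial, term_mul_term, monomial]
  simp only [term, mul_one]
  exact (Finsupp.smul_single_one _ _).symm

theorem zero_mul' (x : Torus h Λ) : 0 * x = 0 := by
  exact DFunLike.congr_fun (map_zero (mulHom h Λ)) x

theorem mul_zero' (x : Torus h Λ) : x * 0 = 0 := map_zero (mulHom h Λ x)

theorem add_mul' (x y z : Torus h Λ) : (x + y) * z = x * z + y * z := by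
  exact DFunLike.congr_fun (map_add (mulHom h Λ) x y) z

theorem mul_add' (x y z : Torus h Λ) : x * (y + z) = x * y + x * z := map_add (mulHom h Λ x) y z

theorem one_mul' (x : Torus h Λ) : 1 * x = x := by
  refine induction_on h Λ (p := fun x => 1 * x = x) x (mul_zero' h Λ _)
    (fun x y hx hy => ?_) (fun e r => ?_)
  · rw [mul_add', hx, hy]
  · change term h Λ 0 1 * term h Λ e r = _
    rw [term_mul_term]; simp [form]

theorem mul_one' (x : Torus h Λ) : x * 1 = x := by
  refine induction_on h Λ (p := fun x => x * 1 = x) x (zero_mul' h Λ _)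
    (fun x y hx hy => ?_) (fun e r => ?_)
  · rw [add_mul', hx, hy]
  · change term h Λ e r * term h Λ 0 1 = _
    rw [term_mul_term]; simp [form]

theorem mul_assoc' (x y z : Torus h Λ) : x * y * z = x * (y * z) := by
  refine induction_on h Λ (p := fun x => x * y * z = x * (y * z)) x ?_
    (fun x x' hx hx' => ?_) (fun e r => ?_)
  · simp only [zero_mul']
  · simp only [add_mul', hx, hx']
  refine induction_on h Λ (p := fun y => term h Λ e r * y * z = term h Λ e r * (y * z)) y ?_
    (fun y y' hy hy' => ?_) (fun f s => ?_)
  · simp only [zero_mul', mul_zero']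
  · simp only [add_mul', mul_add', hy, hy']
  refine induction_on h Λ
    (p := fun z => term h Λ e r * term h Λ f s * z = term h Λ e r * (term h Λ f s * z)) z ?_
    (fun z z' hz hz' => ?_) (fun g t => ?_)
  · simp only [mul_zero']
  · simp only [mul_add', hz, hz']
  simp only [term_mul_term, add_assoc]
  congr 1
  simp only [form, Matrix.mulVec_add, add_dotProduct, dotProduct_add, zpow_add, Units.val_mul]
  ring

noncomputable instance : Ring (Torus h Λ) :=
  { (inferInstance : AddCommGroup (Torus h Λ)),
    (inferInstance : Mul (Torus h Λ)), (inferInstance : One (Torus h Λ)) with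
    zero_mul := zero_mul' h Λ
    mul_zero := mul_zero' h Λ
    left_distrib := mul_add' h Λ
    right_distrib := add_mul' h Λ
    one_mul := one_mul' h Λ
    mul_one := mul_one' h Λ
    mul_assoc := mul_assoc' h Λ }

end Torus

/-! ### The coefficient rings -/

/-- The ring `ℤ[N^{±1/2}]`, as a subring of the real numbers. -/
noncomputable abbrev SqrtRing (N : ℕ) : Subring ℝ :=
  Subring.closure {Real.sqrt N, (Real.sqrt N)⁻¹}

/-- The unit `N^{1/2}` of `ℤ[N^{±1/2}]`. -/
noncomputable def sqrtUnit (N : ℕ) (hN : N ≠ 0) : (SqrtRing N)ˣ where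
  val := ⟨Real.sqrt N, Subring.subset_closure (by simp)⟩
  inv := ⟨(Real.sqrt N)⁻¹, Subring.subset_closure (by simp)⟩
  val_inv := by
    ext
    exact mul_inv_cancel₀ (by positivity)
  inv_val := by
    ext
    exact inv_mul_cancel₀ (by positivity)

/-- The unit `q^{1/2}` of the ring of Laurent polynomials `ℤ[q^{±1/2}]` in the formal variable
`q^{1/2}`. -/
noncomputable def formalUnit : (LaurentPolynomial ℤ)ˣ where
  val := LaurentPolynomial.T 1
  inv := LaurentPolynomial.T (-1)
  val_inv := by rw [← LaurentPolynomial.T_add]; simp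
  inv_val := by rw [← LaurentPolynomial.T_add]; simp

/-! ### Ice quivers and the quantum Caldero–Chapoton map -/

section IceQuiver

variable {V : Type} [Quiver.{0} V] (C : Finset V)

/-- The matrix `B̃` of an ice quiver with frozen vertices `C`:
`b_{ij}` is the number of arrows `i ⟶ j` minus the number of arrows `j ⟶ i`. -/
noncomputable def bTilde : Matrix V (Principal C) ℤ :=
  fun i j => (Nat.card (i ⟶ j.1) : ℤ) - (Nat.card (j.1 ⟶ i) : ℤ)

/-- The columns, indexed by the principal vertices, of the identity matrix. -/
noncomputable def iTilde [DecidableEq V] : Matrix V (Principal C) ℤ :=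
  (1 : Matrix V V ℤ).submatrix id Subtype.val

/-- The columns, indexed by the principal vertices, of the matrix of the `dim Ext¹(S_i, S_j)`. -/
noncomputable def rTilde : Matrix V (Principal C) ℤ := (extMatrix V).submatrix id Subtype.val

variable [Fintype V] [DecidableEq V] {C}

/-- The quantum Caldero–Chapoton map at a finite-dimensional module `M` over the principal part, of
dimension vector `m`: the sum over `e` of
`|Gr_e M| q^{-⟨e, m - e⟩ / 2} X^{B̃ e - (Ĩ - R̃) m}`. As `Gr_e M` is empty unless `e ≤ m`, the sum
extends over these `e` only. -/
noncomputable def quantumCC {R : Type*} [CommRing R] (h : Rˣ) (Λ : Matrix V V ℤ)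
    {k : Type u} [Field k] (M : Rep k (Principal C)) : Torus h Λ :=
  let m : Principal C → ℤ := fun i => (M.dimVector i : ℤ)
  ∑ e ∈ Finset.Iic M.dimVector,
    let e' : Principal C → ℤ := fun i => (e i : ℤ)
    ((Nat.card (M.Gr e) : R) * ((h ^ (-eulerForm e' (m - e')) : Rˣ) : R)) •
      Torus.monomial h Λ (bTilde C *ᵥ e' - (iTilde C - rTilde C) *ᵥ m)

end IceQuiver

end TameQuiver

namespace TameQuiver

/-! ### The Euler form of a tame quiver -/

section EulerForm

variable {V : Type} [Quiver.{0} V] [Fintype V]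

/-! A regular simple module of dimension vector `δ` is stable: it is a brick, and its proper nonzero
submodules have negative defect `⟨δ, -⟩`. Stability alone determines the Grassmannian counts.

Let `E`, `E'` be stable and `W` a proper quotient of `E`. Then `Ext¹(E', W) = 0`, also for `E' = E`
(`IsStable.ext_eq_zero`), so `dim Hom(E', W) = ⟨δ, dim W⟩` is the same for all stable modules.
Sorting homomorphisms by image gives `|Hom(E, W)| = ∑_{U ≤ W} |Surj(E, U)|`, and induction on `dim
W` yields `|Surj(E, W)| = |Surj(E', W)|` whenever `dim W` is below `δ` and distinct from it
(`IsStable.card_surjHom_eq`). A submodule of dimension vector `e` is the kernel of surjections to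
coordinate spaces of dimension vector `w = δ - e`; hence `|Gr_e(E)| ∏ |GL_{w_i}|` is a sum of
numbers `|Surj(E, W)|` (`card_gr_mul`). Finally `X_M` depends on `M` only through its dimension
vector and these counts.

The vanishing rests on Auslander–Reiten duality. A nonzero class in `Ext¹(E', W)` gives a nonzero
map `W → τE'`; the composite `E → τE'` has kernel of negative defect, hence image of positive
defect, and this image receives a nonzero map from `τE'`. As `τE'` is again a brick of dimension
vector `δ`, this is impossible.

Stability is obtained without classifying indecomposables. The quadratic form is nonnegative, and
positive at nonzero vectors below and distinct from `δ`. An indecomposable module that is not a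
brick contains a smaller indecomposable with self-extensions (`IsIndecomposable.exists_selfExt`), so
indecomposables of dimension vector `δ` are bricks. The translate `τ` does not lower the defect, and
it kills a nonzero module only if the defect is negative; dually for `τ⁻`. So preprojectives have
negative and preinjectives positive defect, and a proper nonzero submodule of defect zero would be
regular (`IsRegularSimple.isStable`). -/

theorem eulerForm_apply (e f : V → ℤ) : eulerForm e f =
    ∑ v, e v * f v - ∑ i, ∑ j, (Nat.card (i ⟶ j) : ℤ) * (e j * f i) := by
  simp only [eulerForm, dotProduct, Matrix.mulVec, extMatrix]
  congr 1
  rw [Finset.sum_comm]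
  refine Finset.sum_congr rfl fun i _ => ?_
  rw [Finset.mul_sum]
  exact Finset.sum_congr rfl fun j _ => by ring

theorem eulerForm_add_left (e e' f : V → ℤ) :
    eulerForm (e + e') f = eulerForm e f + eulerForm e' f := by
  simp only [eulerForm, add_dotProduct]; ring

theorem eulerForm_add_right (e f f' : V → ℤ) :
    eulerForm e (f + f') = eulerForm e f + eulerForm e f' := by
  simp only [eulerForm, dotProduct_add, Matrix.mulVec_add]; ring

theorem eulerForm_smul_left (c : ℤ) (e f : V → ℤ) :
    eulerForm (c • e) f = c * eulerForm e f := by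
  simp only [eulerForm, smul_dotProduct, smul_eq_mul]; ring

theorem eulerForm_smul_right (c : ℤ) (e f : V → ℤ) :
    eulerForm e (c • f) = c * eulerForm e f := by
  simp only [eulerForm, dotProduct_smul, Matrix.mulVec_smul, smul_eq_mul]; ring

theorem eulerForm_eq_sum_left (e f : V → ℤ) : eulerForm e f =
    ∑ v, e v * (f v - ∑ i, (Nat.card (i ⟶ v) : ℤ) * f i) := by
  rw [eulerForm_apply, Finset.sum_comm, ← Finset.sum_sub_distrib]
  refine Finset.sum_congr rfl fun v _ => ?_
  rw [mul_sub, Finset.mul_sum]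
  congr 1
  exact Finset.sum_congr rfl fun i _ => by ring

theorem eulerForm_eq_sum_right (e f : V → ℤ) : eulerForm e f =
    ∑ v, f v * (e v - ∑ j, (Nat.card (v ⟶ j) : ℤ) * e j) := by
  rw [eulerForm_apply, ← Finset.sum_sub_distrib]
  refine Finset.sum_congr rfl fun v _ => ?_
  rw [mul_sub, Finset.mul_sum, mul_comm]
  congr 1
  exact Finset.sum_congr rfl fun i _ => by ring

/-- The orientation drops out: only the number of edges between two vertices matters, so positivity
can be checked on the underlying diagram. -/
theorem two_mul_eulerForm_self (x : V → ℤ) : 2 * eulerForm x x =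
    2 * ∑ v, x v ^ 2 - ∑ i, ∑ j, ((Nat.card (i ⟶ j) + Nat.card (j ⟶ i) : ℕ) : ℤ) * (x i * x j) := by
  have h : ∑ i, ∑ j, ((Nat.card (i ⟶ j) + Nat.card (j ⟶ i) : ℕ) : ℤ) * (x i * x j) =
      ∑ i, ∑ j, (Nat.card (i ⟶ j) : ℤ) * (x j * x i) +
        ∑ i, ∑ j, (Nat.card (i ⟶ j) : ℤ) * (x j * x i) := by
    nth_rw 3 [Finset.sum_comm]
    rw [← Finset.sum_add_distrib]
    refine Finset.sum_congr rfl fun i _ => ?_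
    rw [← Finset.sum_add_distrib]
    exact Finset.sum_congr rfl fun j _ => by push_cast; ring
  rw [h, eulerForm_apply]
  simp only [pow_two]
  ring

/-- A vector at which a nonnegative Euler form vanishes lies in the radical of its
symmetrization. -/
theorem eulerForm_add_eulerForm_swap_eq_zero (hq : ∀ x : V → ℤ, 0 ≤ eulerForm x x) {d : V → ℤ}
    (hd : eulerForm d d = 0) (x : V → ℤ) : eulerForm d x + eulerForm x d = 0 := by
  -- The form at `t • d + x` is affine in `t` because it vanishes at `d`; being nonnegative for all
  -- integers `t`, it has slope zero.
  have key : ∀ t : ℤ, 0 ≤ t * (eulerForm d x + eulerForm x d) + eulerForm x x := by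
    intro t
    have := hq (t • d + x)
    simp only [eulerForm_add_left, eulerForm_add_right, eulerForm_smul_left, eulerForm_smul_right,
      hd] at this
    linarith
  set s := eulerForm d x + eulerForm x d
  have hx := hq x
  by_contra hs
  have h1 := key (-s * (eulerForm x x + 1))
  have h2 : 0 < s ^ 2 := by positivity
  nlinarith

end EulerForm

/-! ### Positivity and connectedness of the extended Dynkin diagrams. -/

namespace ExtendedDynkin

theorem edges_valid (D : ExtendedDynkin) :
    ∀ e ∈ D.edges, e.1 < D.size ∧ e.2 < D.size ∧ e.1 ≠ e.2 := by
  rintro e he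
  cases D with
  | A n =>
    simp only [edges, List.mem_append, List.mem_map, List.mem_range, List.mem_singleton] at he
    simp only [size]
    rcases he with ⟨i, hi, rfl⟩ | rfl <;> dsimp only <;> omega
  | D n =>
    simp only [edges, List.mem_append, List.mem_map, List.mem_range, List.mem_cons,
      List.not_mem_nil, or_false] at he
    simp only [size]
    rcases he with ((rfl | rfl) | ⟨i, hi, rfl⟩) | rfl | rfl <;> dsimp only <;> omega
  | E6 => revert e; decide
  | E7 => revert e; decide
  | E8 => revert e; decide

theorem sum_chain_sq (g : ℕ → ℤ) (n : ℕ) :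
    ∑ i ∈ Finset.range n, (g i - g (i + 1)) ^ 2 =
      2 * ∑ i ∈ Finset.range (n + 1), g i ^ 2 - g 0 ^ 2 - g n ^ 2 -
        2 * ∑ i ∈ Finset.range n, g i * g (i + 1) := by
  induction n with
  | zero => simp; ring
  | succ n ih =>
    rw [Finset.sum_range_succ, ih, Finset.sum_range_succ _ (n + 1),
      Finset.sum_range_succ (fun i => g i * g (i + 1)) n]
    ring

theorem sum_map_range (g : ℕ → ℤ) (n : ℕ) :
    ((List.range n).map g).sum = ∑ i ∈ Finset.range n, g i := by
  rfl

/-- Since twice each coordinate of `δ` is the sum of the neighbouring ones, the difference of the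
two sides is the sum over the edges `i — j` of `(δ_j g_i - δ_i g_j)² / (2 δ_i δ_j)`. The squares
supplied below are these, up to scaling. -/
theorem sum_edges_le (D : ExtendedDynkin) (g : ℕ → ℤ) :
    (D.edges.map fun e => g e.1 * g e.2).sum ≤ ∑ i ∈ Finset.range D.size, g i ^ 2 := by
  cases D with
  | A n =>
    have h := sum_chain_sq g (n + 1)
    have h0 : 0 ≤ ∑ i ∈ Finset.range (n + 1), (g i - g (i + 1)) ^ 2 :=
      Finset.sum_nonneg fun i _ => sq_nonneg _
    simp only [edges, size, List.map_append, List.sum_append, List.map_map, List.map_cons,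
      List.map_nil, List.sum_cons, List.sum_nil]
    change ((List.range (n + 1)).map fun i => g i * g (i + 1)).sum + _ ≤ _
    rw [sum_map_range]
    nlinarith [sq_nonneg (g (n + 1) - g 0)]
  | D n =>
    have h := sum_chain_sq (fun i => g (i + 2)) n
    have h0 : 0 ≤ ∑ i ∈ Finset.range n, (g (i + 2) - g (i + 1 + 2)) ^ 2 :=
      Finset.sum_nonneg fun i _ => sq_nonneg _
    simp only [edges, size, List.map_append, List.sum_append, List.map_map, List.map_cons,
      List.map_nil, List.sum_cons, List.sum_nil]
    change _ + ((List.range n).map fun i => g (i + 2) * g (i + 1 + 2)).sum + _ ≤ _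
    rw [sum_map_range, Finset.sum_range_succ, Finset.sum_range_succ, Finset.sum_range_succ',
      Finset.sum_range_succ']
    simp only [zero_add, add_assoc, Nat.reduceAdd] at h h0 ⊢
    nlinarith [sq_nonneg (2 * g 0 - g 2), sq_nonneg (2 * g 1 - g 2),
      sq_nonneg (2 * g (n + 3) - g (n + 2)), sq_nonneg (2 * g (n + 4) - g (n + 2))]
  | E6 =>
    simp only [edges, size, List.map_cons, List.map_nil, List.sum_cons, List.sum_nil,
      Finset.sum_range_succ, Finset.sum_range_zero]
    nlinarith [sq_nonneg (2 * g 0 - 3 * g 1), sq_nonneg (g 1 - 2 * g 2),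
      sq_nonneg (2 * g 0 - 3 * g 3), sq_nonneg (g 3 - 2 * g 4),
      sq_nonneg (2 * g 0 - 3 * g 5), sq_nonneg (g 5 - 2 * g 6)]
  | E7 =>
    simp only [edges, size, List.map_cons, List.map_nil, List.sum_cons, List.sum_nil,
      Finset.sum_range_succ, Finset.sum_range_zero]
    nlinarith [sq_nonneg (g 0 - 2 * g 1), sq_nonneg (3 * g 0 - 4 * g 2),
      sq_nonneg (2 * g 2 - 3 * g 3), sq_nonneg (g 3 - 2 * g 4), sq_nonneg (3 * g 0 - 4 * g 5),
      sq_nonneg (2 * g 5 - 3 * g 6), sq_nonneg (g 6 - 2 * g 7)]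
  | E8 =>
    simp only [edges, size, List.map_cons, List.map_nil, List.sum_cons, List.sum_nil,
      Finset.sum_range_succ, Finset.sum_range_zero]
    nlinarith [sq_nonneg (g 0 - 2 * g 1), sq_nonneg (2 * g 0 - 3 * g 2),
      sq_nonneg (g 2 - 2 * g 3), sq_nonneg (5 * g 0 - 6 * g 4), sq_nonneg (4 * g 4 - 5 * g 5),
      sq_nonneg (3 * g 5 - 4 * g 6), sq_nonneg (2 * g 6 - 3 * g 7), sq_nonneg (g 7 - 2 * g 8)]

/-- An edge is seen by two ordered pairs, distinct because there are no loops; hence the factor 2.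
-/
theorem sum_countP (L : List (ℕ × ℕ)) (n : ℕ) (hL : ∀ e ∈ L, e.1 < n ∧ e.2 < n ∧ e.1 ≠ e.2)
    (g : ℕ → ℤ) :
    ∑ i ∈ Finset.range n, ∑ j ∈ Finset.range n,
      (L.countP (fun e => decide (e = (i, j) ∨ e = (j, i))) : ℤ) * (g i * g j) =
      2 * (L.map fun e => g e.1 * g e.2).sum := by
  induction L with
  | nil => simp
  | cons e L ih =>
    obtain ⟨h1, h2, h3⟩ := hL e (by simp)
    simp only [List.countP_cons, List.map_cons, List.sum_cons, mul_add]
    rw [← ih fun e he => hL e (by simp [he])]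
    push_cast
    simp only [add_mul, Finset.sum_add_distrib]
    rw [add_comm]
    congr 1
    have h4 : ∀ i j : ℕ, ((if decide (e = (i, j) ∨ e = (j, i)) = true then 1 else 0 : ℤ)) *
        (g i * g j) = (if i = e.1 then (if j = e.2 then g i * g j else 0) else 0) +
          (if i = e.2 then (if j = e.1 then g i * g j else 0) else 0) := by
      intro i j
      obtain ⟨a, b⟩ := e
      simp only [decide_eq_true_eq, Prod.mk.injEq]
      dsimp only at h3
      split_ifs <;> omega
    simp only [h4, Finset.sum_add_distrib, Finset.sum_ite_irrel, Finset.sum_ite_eq',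
      Finset.sum_const_zero, Finset.mem_range, h1, h2, if_true]
    ring

/-- An extended Dynkin diagram is connected. -/
theorem connected (D : ExtendedDynkin) (p : ℕ → Prop) (hp : ∀ e ∈ D.edges, (p e.1 ↔ p e.2)) :
    ∃ c, ∀ i < D.size, (p i ↔ p c) := by
  cases D with
  | A n =>
    refine ⟨0, fun i => ?_⟩
    induction i with
    | zero => simp
    | succ i ih =>
      intro hi
      simp only [size] at hi ih
      rw [← ih (by omega)]
      exact (hp (i, i + 1) (by simp [edges]; omega)).symm
  | D n =>
    have hc : ∀ i ≤ n, (p (i + 2) ↔ p 2) := by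
      intro i
      induction i with
      | zero => simp
      | succ i ih =>
        intro hi
        rw [← ih (by omega)]
        refine (hp (i + 2, i + 3) ?_).symm
        simp only [edges, List.mem_append, List.mem_map, List.mem_range]
        exact Or.inl (Or.inr ⟨i, by omega, rfl⟩)
    have h0 := hp (0, 2) (by simp [edges])
    have h1 := hp (1, 2) (by simp [edges])
    have h3 := hp (n + 2, n + 3) (by simp [edges])
    have h4 := hp (n + 2, n + 4) (by simp [edges])
    refine ⟨2, fun i hi => ?_⟩
    simp only [size] at hi
    have hn := hc n le_rfl
    rcases Nat.lt_or_ge i 2 with h | h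
    · interval_cases i
      · exact h0
      · exact h1
    · rcases Nat.lt_or_ge i (n + 3) with h' | h'
      · obtain ⟨j, rfl⟩ := Nat.exists_eq_add_of_le' h
        exact hc j (by omega)
      · have : i = n + 3 ∨ i = n + 4 := by omega
        rcases this with rfl | rfl
        · exact h3.symm.trans hn
        · exact h4.symm.trans hn
  | E6 =>
    simp only [edges, List.forall_mem_cons, List.not_mem_nil, false_implies, implies_true,
      and_true] at hp
    refine ⟨0, fun i hi => ?_⟩
    simp only [size] at hi
    interval_cases i <;> grind
  | E7 =>
    simp only [edges, List.forall_mem_cons, List.not_mem_nil, false_implies, implies_true,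
      and_true] at hp
    refine ⟨0, fun i hi => ?_⟩
    simp only [size] at hi
    interval_cases i <;> grind
  | E8 =>
    simp only [edges, List.forall_mem_cons, List.not_mem_nil, false_implies, implies_true,
      and_true] at hp
    refine ⟨0, fun i hi => ?_⟩
    simp only [size] at hi
    interval_cases i <;> grind

end ExtendedDynkin

/-! ### The minimal imaginary root of a tame quiver. -/

section Tame

variable {V : Type} [Quiver.{0} V] [Fintype V]

theorem IsTame.eulerForm_self_nonneg (hQ : IsTame V) (x : V → ℤ) : 0 ≤ eulerForm x x := by
  obtain ⟨-, -, D, f, hD⟩ := hQ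
  let g : ℕ → ℤ := fun n => if h : n < D.size then x (f.symm ⟨n, h⟩) else 0
  have hg : ∀ v, x v = g (f v) := fun v => by simp [g]
  have h1 := two_mul_eulerForm_self x
  simp only [hD, hg] at h1
  rw [Equiv.sum_comp f (fun i : Fin D.size => g i ^ 2),
    Equiv.sum_comp f (fun i : Fin D.size => ∑ j, (D.edgeCount i (f j) : ℤ) * (g i * g (f j))),
    Fin.sum_univ_eq_sum_range (fun i => g i ^ 2)] at h1
  have h2 : ∀ i : Fin D.size, ∑ j, (D.edgeCount i (f j) : ℤ) * (g i * g (f j)) =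
      ∑ j ∈ Finset.range D.size, (D.edgeCount i j : ℤ) * (g i * g j) := fun i => by
    rw [Equiv.sum_comp f (fun j : Fin D.size => (D.edgeCount i j : ℤ) * (g i * g j)),
      Fin.sum_univ_eq_sum_range (fun j => (D.edgeCount i j : ℤ) * (g i * g j))]
  simp only [h2] at h1
  rw [Fin.sum_univ_eq_sum_range (fun i => ∑ j ∈ Finset.range D.size,
    (D.edgeCount i j : ℤ) * (g i * g j)) D.size] at h1
  have h3 := ExtendedDynkin.sum_countP D.edges D.size D.edges_valid g
  have h4 := D.sum_edges_le g
  simp only [ExtendedDynkin.edgeCount] at h1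
  linarith

/-- The defect `⟨δ, x⟩` is `-⟨x, δ⟩`. -/
theorem IsMinimalImaginaryRoot.swap (hQ : IsTame V) {δ : V → ℕ} (hδ : IsMinimalImaginaryRoot δ)
    (x : V → ℤ) :
    eulerForm (fun i => (δ i : ℤ)) x = -eulerForm x (fun i => (δ i : ℤ)) := by
  have := eulerForm_add_eulerForm_swap_eq_zero hQ.eulerForm_self_nonneg hδ.1.2 x
  linarith

/-- The minimal imaginary root is sincere. -/
theorem IsMinimalImaginaryRoot.pos (hQ : IsTame V) {δ : V → ℕ} (hδ : IsMinimalImaginaryRoot δ)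
    (v : V) : 0 < δ v := by
  classical
  -- For the unit vector at `v` with `δ v = 0`, the lemma `swap` says that the sums of `δ` over
  -- outgoing and over incoming arrows are opposite. Both are nonnegative, so both vanish: zeros of
  -- `δ` spread to neighbours, and connectedness would give `δ = 0`.
  have key : ∀ v w : V, Nat.card (v ⟶ w) + Nat.card (w ⟶ v) ≠ 0 → δ v = 0 → δ w = 0 := by
    intro v w hvw hv
    have h := hδ.swap hQ (Pi.single v 1)
    rw [eulerForm_eq_sum_right, eulerForm_eq_sum_left] at h
    simp only [Pi.single_apply, ite_mul, one_mul, zero_mul, Finset.sum_ite_eq',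
      Finset.mem_univ, if_true, hv, Nat.cast_zero, zero_sub, neg_neg] at h
    have h1 : 0 ≤ ∑ j, (Nat.card (v ⟶ j) : ℤ) * (δ j : ℤ) :=
      Finset.sum_nonneg fun j _ => by positivity
    have h2 : 0 ≤ ∑ j, (Nat.card (j ⟶ v) : ℤ) * (δ j : ℤ) :=
      Finset.sum_nonneg fun j _ => by positivity
    have h3 := (Finset.sum_eq_zero_iff_of_nonneg fun j _ => by positivity).1
      (show ∑ j, (Nat.card (v ⟶ j) : ℤ) * (δ j : ℤ) = 0 by linarith) w (Finset.mem_univ _)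
    have h4 := (Finset.sum_eq_zero_iff_of_nonneg fun j _ => by positivity).1
      (show ∑ j, (Nat.card (j ⟶ v) : ℤ) * (δ j : ℤ) = 0 by linarith) w (Finset.mem_univ _)
    have h5 : Nat.card (v ⟶ w) * δ w = 0 := by exact_mod_cast h3
    have h6 : Nat.card (w ⟶ v) * δ w = 0 := by exact_mod_cast h4
    rcases Nat.mul_eq_zero.1 h5 with h | h
    · rcases Nat.mul_eq_zero.1 h6 with h' | h'
      · omega
      · exact h'
    · exact h
  by_contra hv
  obtain ⟨D, f, hD⟩ := hQ.2.2
  let p : ℕ → Prop := fun n => ∀ h : n < D.size, δ (f.symm ⟨n, h⟩) = 0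
  have hp : ∀ e ∈ D.edges, (p e.1 ↔ p e.2) := by
    intro e he
    obtain ⟨h1, h2, -⟩ := D.edges_valid e he
    have hne : ∀ i j, (e = (i, j) ∨ e = (j, i)) → D.edgeCount i j ≠ 0 := by
      intro i j h
      rw [ExtendedDynkin.edgeCount, ← Nat.pos_iff_ne_zero, List.countP_pos_iff]
      exact ⟨e, he, by simpa using h⟩
    constructor
    · intro h _
      refine key _ _ ?_ (h h1)
      rw [hD]
      simpa using hne e.1 e.2 (Or.inl rfl)
    · intro h _
      refine key _ _ ?_ (h h2)
      rw [hD]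
      simpa using hne e.2 e.1 (Or.inr rfl)
  obtain ⟨c, hc⟩ := D.connected p hp
  have hpv : p (f v) := fun h => by simpa using hv
  refine hδ.1.1 (funext fun w => ?_)
  have := (hc (f w) (f w).2).2 ((hc (f v) (f v).2).1 hpv) (f w).2
  simpa using this

/-- A nonzero vector that is smaller than the minimal imaginary root has positive norm. -/
theorem IsMinimalImaginaryRoot.eulerForm_pos (hQ : IsTame V) {δ : V → ℕ}
    (hδ : IsMinimalImaginaryRoot δ) {x : V → ℕ} (hx : x ≠ 0) (hle : x ≤ δ) (hne : x ≠ δ) :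
    0 < eulerForm (fun i => (x i : ℤ)) (fun i => (x i : ℤ)) := by
  refine lt_of_le_of_ne (hQ.eulerForm_self_nonneg _) fun h => hne (le_antisymm hle ?_)
  exact hδ.2 ⟨hx, h.symm⟩

end Tame

end TameQuiver

namespace TameQuiver

namespace Rep

variable {k : Type u} [Field k] {V : Type} [Quiver.{0} V]

/-! ### Homomorphisms and submodules -/

/-- Finite-dimensional modules. -/
class FinDim (M : Rep k V) : Prop where
  finite : ∀ i, Module.Finite k (M.obj i)

instance (M : Rep k V) [h : M.FinDim] (i : V) : Module.Finite k (M.obj i) := h.finite i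

theorem HasDimVector.finDim {M : Rep k V} {d : V → ℕ} (h : M.HasDimVector d) : M.FinDim :=
  ⟨fun i => (h i).1⟩

theorem HasDimVector.dimVector_eq {M : Rep k V} {d : V → ℕ} (h : M.HasDimVector d) :
    M.dimVector = d :=
  funext fun i => (h i).2

theorem hasDimVector_dimVector (M : Rep k V) [M.FinDim] : M.HasDimVector M.dimVector :=
  fun _ => ⟨inferInstance, rfl⟩

instance (M : Rep k V) [M.FinDim] (U : Sub M) : U.toRep.FinDim :=
  ⟨fun i => inferInstanceAs (Module.Finite k (U.carrier i))⟩

namespace Hom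

/-- The identity homomorphism. -/
def id (M : Rep k V) : Hom M M := ⟨fun _ => LinearMap.id, fun _ => rfl⟩

/-- Composition of homomorphisms. -/
def comp {M N L : Rep k V} (g : Hom N L) (f : Hom M N) : Hom M L where
  app i := g.app i ∘ₗ f.app i
  comm a := by rw [LinearMap.comp_assoc, f.comm, ← LinearMap.comp_assoc, g.comm,
    LinearMap.comp_assoc]

@[simp] theorem comp_app {M N L : Rep k V} (g : Hom N L) (f : Hom M N) (i : V) (x : M.obj i) :
    (g.comp f).app i x = g.app i (f.app i x) := rfl

theorem comm_apply {M N : Rep k V} (f : Hom M N) {i j : V} (a : i ⟶ j) (x : M.obj j) :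
    f.app i (M.map a x) = N.map a (f.app j x) :=
  LinearMap.congr_fun (f.comm a) x

/-- A homomorphism that is not zero. -/
def NeZero {M N : Rep k V} (f : Hom M N) : Prop := ∃ i x, f.app i x ≠ 0

/-- Injective homomorphisms. -/
def Inj {M N : Rep k V} (f : Hom M N) : Prop := ∀ i, Function.Injective (f.app i)

/-- Surjective homomorphisms. -/
def Surj {M N : Rep k V} (f : Hom M N) : Prop := ∀ i, Function.Surjective (f.app i)

/-- The kernel. -/
def ker {M N : Rep k V} (f : Hom M N) : Sub M where
  carrier i := LinearMap.ker (f.app i)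
  map_mem a x hx := by
    rw [LinearMap.mem_ker] at hx ⊢
    rw [f.comm_apply, hx, map_zero]

/-- The image. -/
def range {M N : Rep k V} (f : Hom M N) : Sub N where
  carrier i := LinearMap.range (f.app i)
  map_mem a x hx := by
    obtain ⟨y, rfl⟩ := hx
    exact ⟨M.map a y, f.comm_apply a y⟩

/-- A homomorphism with values in a submodule. -/
def codRestrict {M N : Rep k V} (f : Hom M N) (U : Sub N) (h : ∀ i x, f.app i x ∈ U.carrier i) :
    Hom M U.toRep where
  app i := (f.app i).codRestrict (U.carrier i) (h i)
  comm a := LinearMap.ext fun x => Subtype.ext (f.comm_apply a x)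

/-- The surjection onto the image. -/
def rangeRestrict {M N : Rep k V} (f : Hom M N) : Hom M f.range.toRep :=
  f.codRestrict f.range fun i x => LinearMap.mem_range_self (f.app i) x

theorem rangeRestrict_surj {M N : Rep k V} (f : Hom M N) : f.rangeRestrict.Surj := by
  rintro i ⟨_, x, rfl⟩
  exact ⟨x, rfl⟩

end Hom

/-- The inclusion of a submodule. -/
def Sub.incl {M : Rep k V} (U : Sub M) : Hom U.toRep M where
  app i := (U.carrier i).subtype
  comm _ := rfl

theorem Sub.incl_inj {M : Rep k V} (U : Sub M) : U.incl.Inj :=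
  fun i => (U.carrier i).injective_subtype

/-- The projection to a direct summand. -/
noncomputable def Sub.proj {M : Rep k V} (U W : Sub M) (h : IsCompl U.carrier W.carrier) :
    Hom M U.toRep where
  app i := (U.carrier i).projectionOnto (W.carrier i) (Pi.isCompl_iff.1 h i)
  comm {i j} a := by
    refine LinearMap.ext fun x => ?_
    have hj := Pi.isCompl_iff.1 h j
    have hi := Pi.isCompl_iff.1 h i
    obtain ⟨y, z, rfl, -⟩ := Submodule.existsUnique_add_of_isCompl hj x
    have h1 := U.map_mem a y y.2
    have h2 := W.map_mem a z z.2
    change (U.carrier i).projectionOnto (W.carrier i) hi (M.map a (y + z)) =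
      (M.map a).restrict (U.map_mem a) ((U.carrier j).projectionOnto (W.carrier j) hj (y + z))
    rw [map_add, map_add, map_add, Submodule.projectionOnto_apply_of_mem_left hi h1,
      Submodule.projectionOnto_apply_of_mem_right hi h2, Submodule.projectionOnto_apply_left,
      Submodule.projectionOnto_apply_right, add_zero, add_zero]
    rfl

theorem Sub.proj_incl {M : Rep k V} (U W : Sub M) (h : IsCompl U.carrier W.carrier) (i : V)
    (x : U.carrier i) : (U.proj W h).app i (x : M.obj i) = x :=
  Submodule.projectionOnto_apply_left _ x

theorem Sub.proj_add_proj {M : Rep k V} (U W : Sub M) (h : IsCompl U.carrier W.carrier) (i : V)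
    (x : M.obj i) : U.incl.app i ((U.proj W h).app i x) +
      W.incl.app i ((W.proj U h.symm).app i x) = x :=
  Submodule.projection_add_projection_eq_self (Pi.isCompl_iff.1 h i) x

/-! ### Dimension vectors of kernels, images and summands. -/

section Dimension

/-- The dimension vector with integral values. -/
noncomputable def dimInt (M : Rep k V) : V → ℤ := fun i => (M.dimVector i : ℤ)

theorem HasDimVector.dimInt_eq {M : Rep k V} {d : V → ℕ} (h : M.HasDimVector d) :
    M.dimInt = fun i => (d i : ℤ) :=
  funext fun i => congrArg Nat.cast (h i).2

theorem Hom.dimInt_ker_add_range {M N : Rep k V} [M.FinDim] (f : Hom M N) :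
    f.ker.toRep.dimInt + f.range.toRep.dimInt = M.dimInt := by
  funext i
  have := LinearMap.finrank_range_add_finrank_ker (f.app i)
  change ((Module.finrank k (LinearMap.ker (f.app i)) : ℕ) : ℤ) +
    ((Module.finrank k (LinearMap.range (f.app i)) : ℕ) : ℤ) = (Module.finrank k (M.obj i) : ℤ)
  rw [← this]
  push_cast
  ring

theorem dimVector_le_of_inj {M N : Rep k V} [N.FinDim] {f : Hom M N} (hf : f.Inj) :
    M.dimVector ≤ N.dimVector :=
  fun i => LinearMap.finrank_le_finrank_of_injective (hf i)

theorem dimVector_le_of_surj {M N : Rep k V} [M.FinDim] {f : Hom M N} (hf : f.Surj) :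
    N.dimVector ≤ M.dimVector :=
  fun i => LinearMap.finrank_le_finrank_of_surjective (hf i)

theorem isZero_iff_dimVector {M : Rep k V} [M.FinDim] : M.IsZero ↔ M.dimVector = 0 := by
  simp only [IsZero, funext_iff, dimVector, Pi.zero_apply, Module.finrank_zero_iff]

theorem isZero_iff_dimInt {M : Rep k V} [M.FinDim] : M.IsZero ↔ M.dimInt = 0 := by
  rw [isZero_iff_dimVector]
  simp [funext_iff, dimInt]

theorem Sub.isZero_iff {M : Rep k V} (U : Sub M) : U.toRep.IsZero ↔ U.carrier = ⊥ := by
  rw [funext_iff]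
  exact forall_congr' fun i => Submodule.subsingleton_iff_eq_bot (p := U.carrier i)

theorem Sub.dimVector_le {M : Rep k V} [M.FinDim] (U : Sub M) :
    U.toRep.dimVector ≤ M.dimVector := dimVector_le_of_inj U.incl_inj

theorem Sub.eq_top_of_dimVector {M : Rep k V} [M.FinDim] (U : Sub M)
    (h : U.toRep.dimVector = M.dimVector) : U.carrier = ⊤ :=
  funext fun i => Submodule.eq_top_of_finrank_eq (congrFun h i)

theorem Hom.surj_of_inj {M N : Rep k V} [M.FinDim] [N.FinDim] {f : Hom M N} (hf : f.Inj)
    (h : M.dimVector = N.dimVector) : f.Surj := fun i =>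
  (LinearMap.injective_iff_surjective_of_finrank_eq_finrank (congrFun h i)).1 (hf i)

theorem Sub.dimInt_add {M : Rep k V} [M.FinDim] (U W : Sub M) (h : IsCompl U.carrier W.carrier) :
    U.toRep.dimInt + W.toRep.dimInt = M.dimInt := by
  funext i
  have := Submodule.finrank_add_eq_of_isCompl (Pi.isCompl_iff.1 h i)
  change ((Module.finrank k (U.carrier i) : ℕ) : ℤ) + ((Module.finrank k (W.carrier i) : ℕ) : ℤ) =
    (Module.finrank k (M.obj i) : ℤ)
  exact_mod_cast this

variable [Fintype V]

/-- The total dimension. -/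
noncomputable def totalDim (M : Rep k V) : ℕ := ∑ i, M.dimVector i

theorem totalDim_lt {M N : Rep k V} (h : M.dimVector ≤ N.dimVector)
    (hne : M.dimVector ≠ N.dimVector) : M.totalDim < N.totalDim := by
  obtain ⟨i, hi⟩ := Function.ne_iff.1 hne
  exact Finset.sum_lt_sum (fun i _ => h i) ⟨i, Finset.mem_univ _, lt_of_le_of_ne (h i) hi⟩

end Dimension

/-! ### `Hom` and `Ext¹` -/

/-- The space of homomorphisms. -/
abbrev homSpace (M N : Rep k V) : Submodule k (∀ i, M.obj i →ₗ[k] N.obj i) :=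
  LinearMap.ker (extDiff M N)

theorem mem_homSpace {M N : Rep k V} {f : ∀ i, M.obj i →ₗ[k] N.obj i} :
    f ∈ homSpace M N ↔ ∀ (i j : V) (a : i ⟶ j), f i ∘ₗ M.map a = N.map a ∘ₗ f j := by
  rw [LinearMap.mem_ker]
  simp only [funext_iff, extDiff, LinearMap.coe_mk, AddHom.coe_mk, Pi.zero_apply, sub_eq_zero]

/-- Homomorphisms are the elements of `homSpace`. -/
def homEquiv (M N : Rep k V) : Hom M N ≃ homSpace M N where
  toFun f := ⟨f.app, mem_homSpace.2 fun _ _ a => f.comm a⟩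
  invFun f := ⟨f.1, fun a => mem_homSpace.1 f.2 _ _ a⟩
  left_inv _ := rfl
  right_inv _ := rfl

theorem Hom.neZero_iff {M N : Rep k V} (f : Hom M N) : f.NeZero ↔ homEquiv M N f ≠ 0 := by
  rw [Ne, Subtype.ext_iff]
  change _ ↔ ¬ f.app = 0
  rw [funext_iff, not_forall]
  refine exists_congr fun i => ?_
  rw [LinearMap.ext_iff, not_forall]
  rfl

/-- The dimension of `Hom(M, N)`. -/
noncomputable def hom (M N : Rep k V) : ℕ := Module.finrank k (homSpace M N)

/-- The dimension of `Ext¹(M, N)`. -/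
noncomputable def ext (M N : Rep k V) : ℕ := Module.finrank k (Ext1 M N)

theorem ext1Post_surjective (M : Rep k V) {N N' : Rep k V} {φ : Hom N N'} (hφ : φ.Surj) :
    Function.Surjective (ext1Post M φ) := by
  intro z
  obtain ⟨c, rfl⟩ := Submodule.Quotient.mk_surjective _ z
  choose s hs using fun i => (φ.app i).exists_rightInverse_of_surjective
    (LinearMap.range_eq_top.2 (hφ i))
  refine ⟨Submodule.Quotient.mk fun i j a => s i ∘ₗ c i j a, ?_⟩
  refine congrArg Submodule.Quotient.mk ?_
  funext i j a
  exact LinearMap.ext fun x => LinearMap.congr_fun (hs i) _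

theorem ext1Pre_surjective {M M' : Rep k V} {φ : Hom M M'} (hφ : φ.Inj) (N : Rep k V) :
    Function.Surjective (ext1Pre φ N) := by
  intro z
  obtain ⟨c, rfl⟩ := Submodule.Quotient.mk_surjective _ z
  choose s hs using fun i => (φ.app i).exists_leftInverse_of_injective
    (LinearMap.ker_eq_bot.2 (hφ i))
  refine ⟨Submodule.Quotient.mk fun i j a => c i j a ∘ₗ s j, ?_⟩
  refine congrArg Submodule.Quotient.mk ?_
  funext i j a
  exact LinearMap.ext fun x => congrArg (c i j a) (LinearMap.congr_fun (hs j) x)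

theorem exists_hom_of_pos {M N : Rep k V} (h : hom M N ≠ 0) : ∃ f : Hom M N, f.NeZero := by
  by_contra! hf
  refine h (@Module.finrank_zero_of_subsingleton _ _ _ _ _ _ ⟨fun x y => ?_⟩)
  have key : ∀ x : homSpace M N, x = 0 := fun x => by
    have := hf ((homEquiv M N).symm x)
    rwa [Hom.neZero_iff, Equiv.apply_symm_apply, not_not] at this
  rw [key x, key y]

section Finite

variable [Fintype V] [∀ i j : V, Finite (i ⟶ j)]

instance (M N : Rep k V) [M.FinDim] [N.FinDim] : Module.Finite k (Ext1 M N) := by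
  infer_instance

theorem hom_sub_ext (M N : Rep k V) [M.FinDim] [N.FinDim] :
    (hom M N : ℤ) - ext M N = eulerForm M.dimInt N.dimInt :=
  euler_form_eq M.hasDimVector_dimVector N.hasDimVector_dimVector

theorem ext_eq_zero_iff (M N : Rep k V) [M.FinDim] [N.FinDim] :
    ext M N = 0 ↔ Subsingleton (Ext1 M N) := Module.finrank_zero_iff

end Finite

theorem hom_ne_zero [Finite V] {M N : Rep k V} [M.FinDim] [N.FinDim] {f : Hom M N}
    (hf : f.NeZero) : hom M N ≠ 0 := fun h => by
  have := Module.finrank_zero_iff.1 h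
  exact f.neZero_iff.1 hf (Subsingleton.elim _ _)

/-! ### Bricks -/

/-- A brick: a module whose nonzero endomorphisms are injective. -/
def IsBrick (M : Rep k V) : Prop := ∀ f : Hom M M, f.NeZero → f.Inj

/-- A retract of an indecomposable module is zero or the whole module. -/
theorem IsIndecomposable.retract {X K : Rep k V} (hX : X.IsIndecomposable) (ι : Hom K X)
    (π : Hom X K) (h : ∀ i x, π.app i (ι.app i x) = x) :
    K.IsZero ∨ ∀ i x, ι.app i (π.app i x) = x := by
  have hc : IsCompl ι.range.carrier π.ker.carrier := by
    refine Pi.isCompl_iff.2 fun i => ⟨?_, ?_⟩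
    · rw [Submodule.disjoint_def]
      rintro _ ⟨x, rfl⟩ hx
      have hx' : π.app i (ι.app i x) = 0 := hx
      rw [h] at hx'
      rw [hx', map_zero]
    · rw [codisjoint_iff, eq_top_iff]
      intro y _
      refine Submodule.mem_sup.2 ⟨ι.app i (π.app i y), ⟨_, rfl⟩, y - ι.app i (π.app i y), ?_, by simp⟩
      change π.app i (y - ι.app i (π.app i y)) = 0
      rw [map_sub, h, sub_self]
  rcases hX.2 _ _ hc with h0 | h0
  · left
    intro i
    refine ⟨fun x y => ?_⟩
    have key : ∀ x, ι.app i x = 0 := fun x => by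
      have : ι.app i x ∈ ι.range.carrier i := ⟨x, rfl⟩
      rw [h0] at this
      exact this
    rw [← h i x, ← h i y, key, key]
  · right
    intro i x
    have : ι.app i (π.app i x) - x ∈ π.ker.carrier i := by
      change π.app i (ι.app i (π.app i x) - x) = 0
      rw [map_sub, h, sub_self]
    rw [h0] at this
    exact sub_eq_zero.1 this

theorem exists_comp_eq_of_ker_le {X Y Z : Type*} [AddCommGroup X] [Module k X] [AddCommGroup Y]
    [Module k Y] [AddCommGroup Z] [Module k Z] (α : X →ₗ[k] Y) (c : X →ₗ[k] Z)
    (h : LinearMap.ker α ≤ LinearMap.ker c) : ∃ g : Y →ₗ[k] Z, g ∘ₗ α = c := by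
  obtain ⟨s, hs⟩ := α.rangeRestrict.exists_rightInverse_of_surjective α.range_rangeRestrict
  obtain ⟨g, hg⟩ := LinearMap.exists_extend (c ∘ₗ s)
  refine ⟨g, LinearMap.ext fun x => ?_⟩
  have h1 := LinearMap.congr_fun hg (α.rangeRestrict x)
  have h2 := congrArg Subtype.val (LinearMap.congr_fun hs (α.rangeRestrict x))
  have h3 : s (α.rangeRestrict x) - x ∈ LinearMap.ker c := by
    apply h
    rw [LinearMap.mem_ker, map_sub, sub_eq_zero]
    exact h2
  rw [LinearMap.mem_ker, map_sub, sub_eq_zero] at h3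
  exact h1.trans h3

/-- The rank of a homomorphism. -/
noncomputable def Hom.rank [Fintype V] {M N : Rep k V} (f : Hom M N) : ℕ := f.range.toRep.totalDim

/-- A nonzero noninjective endomorphism of minimal rank of an indecomposable module has square
zero. -/
theorem IsIndecomposable.sq_eq_zero [Fintype V] {X : Rep k V} [X.FinDim]
    (hX : X.IsIndecomposable) {θ : Hom X X} (h0 : θ.NeZero) (h1 : ¬ θ.Inj)
    (hmin : ∀ f : Hom X X, f.NeZero → ¬ f.Inj → θ.rank ≤ f.rank) : ¬ (θ.comp θ).NeZero := by
  intro h2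
  -- If the square is nonzero, minimality of the rank gives it the same image as `θ`. Then the
  -- module is the direct sum of the image and the kernel of `θ`, as in Fitting's lemma, which
  -- indecomposability forbids.
  have hr := hmin _ h2 fun h => h1 fun i x y hxy => h i (by simp [hxy])
  have hle : ∀ i, (θ.comp θ).range.carrier i ≤ θ.range.carrier i := by
    rintro i _ ⟨x, rfl⟩
    exact ⟨θ.app i x, rfl⟩
  have heq : ∀ i, (θ.comp θ).range.carrier i = θ.range.carrier i := by
    have hle' : ∀ i ∈ Finset.univ, (θ.comp θ).range.toRep.dimVector i ≤ θ.range.toRep.dimVector i :=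
      fun i _ => Submodule.finrank_mono (hle i)
    have := (Finset.sum_eq_sum_iff_of_le hle').1 (le_antisymm (Finset.sum_le_sum hle') hr)
    exact fun i => Submodule.eq_of_le_of_finrank_eq (hle i) (this i (Finset.mem_univ _))
  have hc : IsCompl θ.range.carrier θ.ker.carrier := by
    refine Pi.isCompl_iff.2 fun i => ?_
    have hs : θ.range.carrier i ⊔ θ.ker.carrier i = ⊤ := by
      rw [eq_top_iff]
      intro y _
      have : θ.app i y ∈ (θ.comp θ).range.carrier i := by rw [heq]; exact ⟨y, rfl⟩
      obtain ⟨z, hz⟩ := this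
      refine Submodule.mem_sup.2 ⟨θ.app i z, ⟨z, rfl⟩, y - θ.app i z, ?_, by simp⟩
      change θ.app i (y - θ.app i z) = 0
      rw [map_sub, ← hz]
      exact sub_self _
    refine ⟨?_, codisjoint_iff.2 hs⟩
    have h3 := Submodule.finrank_sup_add_finrank_inf_eq (θ.range.carrier i) (θ.ker.carrier i)
    have h4 : Module.finrank k (θ.range.carrier i) + Module.finrank k (θ.ker.carrier i) =
      Module.finrank k (X.obj i) := LinearMap.finrank_range_add_finrank_ker (θ.app i)
    rw [hs, finrank_top, h4] at h3
    rw [disjoint_iff]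
    exact Submodule.finrank_eq_zero.1 (by omega)
  rcases hX.2 _ _ hc with h | h
  · obtain ⟨i, x, hx⟩ := h0
    have : θ.app i x ∈ θ.range.carrier i := ⟨x, rfl⟩
    rw [h] at this
    exact hx this
  · exact h1 fun i => LinearMap.ker_eq_bot.1 (congrFun h i)

/-- An indecomposable module that is not a brick has an indecomposable proper submodule with
self-extensions. -/
theorem IsIndecomposable.exists_selfExt [Fintype V] {X : Rep k V} [X.FinDim]
    (hX : X.IsIndecomposable) (hb : ¬ X.IsBrick) :
    ∃ K : Rep k V, K.FinDim ∧ K.IsIndecomposable ∧ K.dimVector ≤ X.dimVector ∧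
      K.dimVector ≠ X.dimVector ∧ ¬ Subsingleton (Ext1 K K) := by
  classical
  -- The plan: the image of a minimal `θ` lies in its kernel and embeds in an indecomposable summand
  -- `K` of that kernel. If `Ext¹(K, K) = 0`, then `Ext¹(im θ, K) = 0`, so the projection of `ker θ`
  -- onto `K` extends to `X`. Then `K` splits off the indecomposable `X`, although it lies in the
  -- proper submodule `ker θ`.
  obtain ⟨θ, ⟨hθ0, hθ1⟩, hmin⟩ : ∃ θ : Hom X X, (θ.NeZero ∧ ¬ θ.Inj) ∧
      ∀ f : Hom X X, f.NeZero → ¬ f.Inj → θ.rank ≤ f.rank := by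
    have hne : {θ : Hom X X | θ.NeZero ∧ ¬ θ.Inj}.Nonempty := by
      simp only [IsBrick, not_forall] at hb
      obtain ⟨f, h, h'⟩ := hb
      exact ⟨f, h, h'⟩
    obtain ⟨θ, h, h'⟩ := (measure (fun θ : Hom X X => θ.rank)).wf.has_min _ hne
    exact ⟨θ, h, fun f hf hf' => not_lt.1 (h' f ⟨hf, hf'⟩)⟩
  have hsq := hX.sq_eq_zero hθ0 hθ1 hmin
  have hZ : ∀ i x, θ.app i x ∈ θ.ker.carrier i := by
    intro i x
    by_contra h
    exact hsq ⟨i, x, h⟩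
  let θ' := θ.codRestrict θ.ker hZ
  -- `K` is a retract of `ker θ` of least total dimension to which the image of `θ` projects
  -- nontrivially.
  have hex : ∃ n, ∃ (K : Rep k V) (_ : K.FinDim) (ι : Hom K θ.ker.toRep) (π : Hom θ.ker.toRep K),
      (∀ i x, π.app i (ι.app i x) = x) ∧ (π.comp θ').NeZero ∧ K.totalDim = n := by
    refine ⟨_, θ.ker.toRep, inferInstance, Hom.id _, Hom.id _, fun _ _ => rfl, ?_, rfl⟩
    obtain ⟨i, x, hx⟩ := hθ0
    exact ⟨i, x, fun h => hx (congrArg Subtype.val h)⟩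
  obtain ⟨K, hK, ι, π, hπι, hne, hdim⟩ := Nat.find_spec hex
  have hKmin := fun m => Nat.find_min' hex (m := m)
  rw [← hdim] at hKmin
  have hιinj : ι.Inj := fun i x y h => by rw [← hπι i x, h, hπι]
  -- `K` is indecomposable by minimality
  have key : ∀ A B : Sub K, ∀ h : IsCompl A.carrier B.carrier,
      ((A.proj B h).comp (π.comp θ')).NeZero → B.carrier = ⊥ := by
    intro A B h hA
    have h1 := hKmin _ ⟨A.toRep, inferInstance, ι.comp A.incl, (A.proj B h).comp π, fun i x => by
      simp only [Hom.comp_app, hπι]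
      exact A.proj_incl B h i x, hA, rfl⟩
    by_contra hB
    have hlt : A.toRep.totalDim < K.totalDim := by
      refine totalDim_lt A.dimVector_le fun he => hB ?_
      have h2 := A.dimInt_add B h
      have h3 : A.toRep.dimInt = K.dimInt := funext fun i => congrArg Nat.cast (congrFun he i)
      rw [h3, add_eq_left] at h2
      exact B.isZero_iff.1 (isZero_iff_dimInt.2 h2)
    omega
  have hKind : K.IsIndecomposable := by
    refine ⟨fun h => ?_, fun A B h => ?_⟩
    · obtain ⟨i, x, hx⟩ := hne
      exact hx ((h i).elim _ _)
    · obtain ⟨i, x, hx⟩ := hne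
      by_cases hA : (A.proj B h).app i ((π.comp θ').app i x) = 0
      · left
        refine key B A h.symm ⟨i, x, fun hB => hx ?_⟩
        rw [← A.proj_add_proj B h i ((π.comp θ').app i x), hA]
        rw [Hom.comp_app] at hB
        rw [hB, map_zero, map_zero, add_zero]
      · exact Or.inr (key A B h ⟨i, x, hA⟩)
  have hle : K.dimVector ≤ X.dimVector := (dimVector_le_of_inj hιinj).trans θ.ker.dimVector_le
  refine ⟨K, hK, hKind, hle, fun he => ?_, fun hext => ?_⟩
  · have h1 := θ.ker.eq_top_of_dimVector
      (le_antisymm θ.ker.dimVector_le (he ▸ dimVector_le_of_inj hιinj))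
    obtain ⟨i, x, hx⟩ := hθ0
    have : x ∈ θ.ker.carrier i := by rw [h1]; trivial
    exact hx this
  -- the kernel of `π ∘ θ` is the kernel of `θ`
  have hker : ∀ i x, π.app i (θ'.app i x) = 0 → θ.app i x = 0 := by
    -- `β` is a nonzero noninjective endomorphism that kills `ker θ`; minimality of the rank of `θ`
    -- forces the two kernels to agree.
    let β : Hom X X := θ.ker.incl.comp (ι.comp (π.comp θ'))
    have hβ0 : β.NeZero := by
      obtain ⟨i, x, hx⟩ := hne
      refine ⟨i, x, fun h => hx (hιinj i ?_)⟩
      rw [map_zero]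
      exact Subtype.ext h
    have hle : ∀ i, LinearMap.ker (θ.app i) ≤ LinearMap.ker (β.app i) := by
      intro i x hx
      have : θ'.app i x = 0 := Subtype.ext hx
      simp [β, this]
    have hβ1 : ¬ β.Inj := fun h => hθ1 fun i => LinearMap.ker_eq_bot.1 <| by
      rw [eq_bot_iff, ← LinearMap.ker_eq_bot.2 (h i)]
      exact hle i
    have hr := hmin β hβ0 hβ1
    have hle' : ∀ i ∈ Finset.univ, β.range.toRep.dimVector i ≤ θ.range.toRep.dimVector i := by
      intro i _
      have h1 := LinearMap.finrank_range_add_finrank_ker (θ.app i)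
      have h2 := LinearMap.finrank_range_add_finrank_ker (β.app i)
      have h3 := Submodule.finrank_mono (hle i)
      change Module.finrank k (LinearMap.range (β.app i)) ≤
        Module.finrank k (LinearMap.range (θ.app i))
      omega
    have h4 := (Finset.sum_eq_sum_iff_of_le hle').1 (le_antisymm (Finset.sum_le_sum hle') hr)
    intro i x hx
    have h5 : LinearMap.ker (θ.app i) = LinearMap.ker (β.app i) := by
      refine Submodule.eq_of_le_of_finrank_eq (hle i) ?_
      have h1 := LinearMap.finrank_range_add_finrank_ker (θ.app i)
      have h2 := LinearMap.finrank_range_add_finrank_ker (β.app i)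
      have h3 : Module.finrank k (LinearMap.range (β.app i)) =
        Module.finrank k (LinearMap.range (θ.app i)) := h4 i (Finset.mem_univ _)
      omega
    change x ∈ LinearMap.ker (θ.app i)
    rw [h5]
    simp [β, hx]
  -- `π` extends to a retraction of `X` onto `K`
  choose p hp using fun i => LinearMap.exists_extend (p := θ.ker.carrier i) (π.app i)
  have hp' : ∀ i (x : θ.ker.carrier i), p i x = π.app i x := fun i x => LinearMap.congr_fun (hp i) x
  -- The failure of the linear extension `p` to commute with the arrows vanishes on `ker θ`, which
  -- is the kernel of `π ∘ θ'`. It therefore factors through `K` and defines a class in `Ext¹(K,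
  -- K)`.
  have hobs : ∀ (i j : V) (a : i ⟶ j), ∃ g : K.obj j →ₗ[k] K.obj i,
      g ∘ₗ (π.comp θ').app j = p i ∘ₗ X.map a - K.map a ∘ₗ p j := by
    intro i j a
    refine exists_comp_eq_of_ker_le _ _ fun x hx => ?_
    have hx' : x ∈ θ.ker.carrier j := hker j x hx
    have h1 := hp' j ⟨x, hx'⟩
    have h2 := hp' i ⟨X.map a x, θ.ker.map_mem a x hx'⟩
    have h3 := π.comm_apply a ⟨x, hx'⟩
    simp only [LinearMap.mem_ker, LinearMap.sub_apply, LinearMap.comp_apply]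
    dsimp only at h1 h2
    rw [h1, h2, ← h3, sub_eq_zero]
    rfl
  choose g hg using hobs
  obtain ⟨h, hh⟩ := (Submodule.Quotient.mk_eq_zero _).1
    (Subsingleton.elim (Submodule.Quotient.mk g : Ext1 K K) 0)
  -- As `g` is the coboundary of `h`, the correction by `h ∘ π ∘ θ'` turns `p` into a homomorphism,
  -- and it does not change `p` on `ker θ`.
  let ρ : Hom X K :=
    { app := fun i => p i - h i ∘ₗ (π.comp θ').app i
      comm := fun {i j} a => by
        refine LinearMap.ext fun x => ?_
        have h1 := LinearMap.congr_fun (hg i j a) x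
        have h2 := LinearMap.congr_fun (congrFun (congrFun (congrFun hh i) j) a)
          ((π.comp θ').app j x)
        have h3 := (π.comp θ').comm_apply a x
        simp only [extDiff, LinearMap.coe_mk, AddHom.coe_mk, LinearMap.sub_apply,
          LinearMap.comp_apply, map_sub] at h1 h2 h3 ⊢
        rw [h3]
        rw [← h2] at h1
        rw [sub_eq_sub_iff_add_eq_add] at h1 ⊢
        rw [← sub_eq_zero] at h1 ⊢
        rw [← neg_eq_zero, ← h1]
        abel }
  rcases hX.retract (θ.ker.incl.comp ι) ρ (fun i x => by
    have h1 : θ.app i (θ.ker.incl.app i (ι.app i x)) = 0 := (ι.app i x).2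
    have h2 : θ'.app i (θ.ker.incl.app i (ι.app i x)) = 0 := Subtype.ext h1
    change p i (θ.ker.incl.app i (ι.app i x)) -
      h i (π.app i (θ'.app i (θ.ker.incl.app i (ι.app i x)))) = x
    rw [h2, map_zero, map_zero, sub_zero]
    exact (hp' i (ι.app i x)).trans (hπι i x)) with h | h
  · exact hKind.1 h
  · obtain ⟨i, x, hx⟩ := hθ0
    apply hx
    rw [← h i x]
    exact (ι.app i (ρ.app i x)).2

end Rep

end TameQuiver

namespace TameQuiver

/-! ### Paths of an acyclic quiver -/

section Paths

variable {V : Type} [Quiver.{0} V]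

theorem IsAcyclic.wellFounded [Finite V] (h : IsAcyclic V) :
    WellFounded fun i j : V => Nonempty (i ⟶ j) := by
  let r : V → V → Prop := fun i j => ∃ p : Quiver.Path i j, p.length ≠ 0
  have : IsTrans V r := ⟨fun a b c ⟨p, hp⟩ ⟨q, _⟩ => ⟨p.comp q, by
    rw [Quiver.Path.length_comp]; omega⟩⟩
  have : Std.Irrefl r := ⟨fun a ⟨p, hp⟩ => hp (h a p)⟩
  exact Subrelation.wf (r := r) (fun {i j} ⟨a⟩ => ⟨a.toPath, by simp [Quiver.Path.length_toPath]⟩)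
    (Finite.wellFounded_of_trans_of_irrefl r)

theorem IsAcyclic.wellFounded_swap [Finite V] (h : IsAcyclic V) :
    WellFounded fun i j : V => Nonempty (j ⟶ i) := by
  let r : V → V → Prop := fun i j => ∃ p : Quiver.Path j i, p.length ≠ 0
  have : IsTrans V r := ⟨fun a b c ⟨p, hp⟩ ⟨q, _⟩ => ⟨q.comp p, by
    rw [Quiver.Path.length_comp]; omega⟩⟩
  have : Std.Irrefl r := ⟨fun a ⟨p, hp⟩ => hp (h a p)⟩
  exact Subrelation.wf (r := r) (fun {i j} ⟨a⟩ => ⟨a.toPath, by simp [Quiver.Path.length_toPath]⟩)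
    (Finite.wellFounded_of_trans_of_irrefl r)

/-- A path is trivial or has a last arrow. -/
noncomputable def pathEquivLast (i v : V) :
    (PLift (i = v) ⊕ Σ j, Quiver.Path i j × (j ⟶ v)) ≃ Quiver.Path i v :=
  Equiv.ofBijective
    (fun x => match x with
      | .inl ⟨h⟩ => h ▸ Quiver.Path.nil
      | .inr ⟨_, p, a⟩ => p.cons a)
    (by
      constructor
      · rintro (⟨⟨rfl⟩⟩ | ⟨j, p, a⟩) (⟨⟨h⟩⟩ | ⟨j', p', a'⟩) hxy
        · rfl
        · cases hxy
        · subst h; cases hxy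
        · cases hxy; rfl
      · rintro (_ | ⟨p, a⟩)
        · exact ⟨.inl ⟨rfl⟩, rfl⟩
        · exact ⟨.inr ⟨_, p, a⟩, rfl⟩)

theorem toPath_comp_ne_nil {v j : V} (a : v ⟶ j) (p : Quiver.Path j v) :
    a.toPath.comp p ≠ Quiver.Path.nil := fun h => by
  have := congrArg Quiver.Path.length h
  rw [Quiver.Path.length_comp, Quiver.Path.length_toPath, Quiver.Path.length_nil] at this
  omega

theorem toPath_comp_inj {v j j' i : V} (a : v ⟶ j) (p : Quiver.Path j i) (a' : v ⟶ j')
    (p' : Quiver.Path j' i) (h : a.toPath.comp p = a'.toPath.comp p') :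
    (⟨j, a, p⟩ : Σ j, (v ⟶ j) × Quiver.Path j i) = ⟨j', a', p'⟩ := by
  induction p with
  | nil =>
    cases p' with
    | nil => cases h; rfl
    | cons q c =>
      simp only [Quiver.Path.comp_cons, Quiver.Path.comp_nil] at h
      have h1 := congrArg Quiver.Path.length h
      simp only [Quiver.Path.length_cons, Quiver.Path.length_comp, Quiver.Path.length_toPath] at h1
      omega
  | cons q c ih =>
    cases p' with
    | nil =>
      simp only [Quiver.Path.comp_cons, Quiver.Path.comp_nil] at h
      have h1 := congrArg Quiver.Path.length h
      simp only [Quiver.Path.length_cons, Quiver.Path.length_comp, Quiver.Path.length_toPath] at h1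
      omega
    | cons q' c' =>
      simp only [Quiver.Path.comp_cons] at h
      obtain rfl := Quiver.Path.obj_eq_of_cons_eq_cons h
      have h1 := eq_of_heq (Quiver.Path.heq_of_cons_eq_cons h)
      have h2 := eq_of_heq (Quiver.Path.hom_heq_of_cons_eq_cons h)
      cases ih q' h1
      rw [h2]

/-- A path is trivial or has a first arrow. -/
noncomputable def pathEquivFirst (v i : V) :
    (PLift (v = i) ⊕ Σ j, (v ⟶ j) × Quiver.Path j i) ≃ Quiver.Path v i :=
  Equiv.ofBijective
    (fun x => match x with
      | .inl ⟨h⟩ => h ▸ Quiver.Path.nil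
      | .inr ⟨_, a, p⟩ => a.toPath.comp p)
    (by
      constructor
      · rintro (⟨⟨rfl⟩⟩ | ⟨j, a, p⟩) (⟨⟨h⟩⟩ | ⟨j', a', p'⟩) hxy
        · rfl
        · exact absurd hxy.symm (toPath_comp_ne_nil a' p')
        · subst h; exact absurd hxy (toPath_comp_ne_nil a p)
        · exact congrArg Sum.inr (toPath_comp_inj a p a' p' hxy)
      · intro p
        induction p with
        | nil => exact ⟨.inl ⟨rfl⟩, rfl⟩
        | cons p c ih =>
          obtain ⟨⟨⟨rfl⟩⟩ | ⟨j, a, q⟩, rfl⟩ := ih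
          · exact ⟨.inr ⟨_, c, Quiver.Path.nil⟩, rfl⟩
          · exact ⟨.inr ⟨j, a, q.cons c⟩, rfl⟩)

theorem IsAcyclic.finite_path [Finite V] [∀ i j : V, Finite (i ⟶ j)] (h : IsAcyclic V) (i v : V) :
    Finite (Quiver.Path i v) := by
  induction v using h.wellFounded.induction with
  | _ v ih =>
    have : ∀ j, Finite (Quiver.Path i j × (j ⟶ v)) := fun j => by
      rcases isEmpty_or_nonempty (j ⟶ v) with hj | hj
      · infer_instance
      · have := ih j hj
        infer_instance
    exact Finite.of_equiv _ (pathEquivLast i v)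

variable [Fintype V] [DecidableEq V] [∀ i j : V, Finite (i ⟶ j)]
  [∀ i j : V, Finite (Quiver.Path i j)]

theorem card_plift (p : Prop) [Decidable p] : Nat.card (PLift p) = if p then 1 else 0 := by
  split_ifs with h
  · have : Unique (PLift p) := ⟨⟨⟨h⟩⟩, fun _ => rfl⟩
    exact Nat.card_unique
  · have : IsEmpty (PLift p) := ⟨fun x => h x.down⟩
    exact Nat.card_of_isEmpty

theorem card_path_last (i v : V) : (Nat.card (Quiver.Path i v) : ℤ) =
    (Pi.single v 1 : V → ℤ) i + ∑ j, (Nat.card (j ⟶ v) : ℤ) * Nat.card (Quiver.Path i j) := by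
  rw [← Nat.card_congr (pathEquivLast i v), Nat.card_sum, Nat.card_sigma, card_plift]
  simp only [Nat.card_prod, Pi.single_apply]
  push_cast
  congr 1
  exact Finset.sum_congr rfl fun j _ => mul_comm _ _

theorem card_path_first (v i : V) : (Nat.card (Quiver.Path v i) : ℤ) =
    (Pi.single v 1 : V → ℤ) i + ∑ j, (Nat.card (v ⟶ j) : ℤ) * Nat.card (Quiver.Path j i) := by
  rw [← Nat.card_congr (pathEquivFirst v i), Nat.card_sum, Nat.card_sigma, card_plift]
  simp only [Nat.card_prod, Pi.single_apply, eq_comm (a := v)]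
  push_cast
  rfl

end Paths

theorem eulerForm_sum_right {V : Type} [Quiver.{0} V] [Fintype V] {ι : Type*} (s : Finset ι)
    (e : V → ℤ) (c : ι → ℤ) (f : ι → V → ℤ) :
    eulerForm e (∑ i ∈ s, c i • f i) = ∑ i ∈ s, c i * eulerForm e (f i) := by
  classical
  induction s using Finset.induction_on with
  | empty => simp [eulerForm]
  | insert a s ha ih =>
    rw [Finset.sum_insert ha, Finset.sum_insert ha, eulerForm_add_right, eulerForm_smul_right, ih]

theorem eulerForm_sum_left {V : Type} [Quiver.{0} V] [Fintype V] {ι : Type*} (s : Finset ι)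
    (f : V → ℤ) (c : ι → ℤ) (e : ι → V → ℤ) :
    eulerForm (∑ i ∈ s, c i • e i) f = ∑ i ∈ s, c i * eulerForm (e i) f := by
  classical
  induction s using Finset.induction_on with
  | empty => simp [eulerForm]
  | insert a s ha ih =>
    rw [Finset.sum_insert ha, Finset.sum_insert ha, eulerForm_add_left, eulerForm_smul_left, ih]

namespace Rep

variable {k : Type u} [Field k] {V : Type} [Quiver.{0} V]

/-! ### Bricks of a tame quiver -/

section Brick

theorem hom_self_ne_zero [Finite V] {K : Rep k V} [K.FinDim] (hK : ¬ K.IsZero) : hom K K ≠ 0 := by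
  refine hom_ne_zero (f := Hom.id K) ?_
  simp only [IsZero, not_forall, not_subsingleton_iff_nontrivial] at hK
  obtain ⟨i, hi⟩ := hK
  obtain ⟨x, hx⟩ := exists_ne (0 : K.obj i)
  exact ⟨i, x, hx⟩

variable [Fintype V] [∀ i j : V, Finite (i ⟶ j)]

/-- A brick with self-extensions has at least as many self-extensions as endomorphisms. -/
theorem IsBrick.hom_le_ext {K : Rep k V} [K.FinDim] (hK : K.IsBrick) (h : ext K K ≠ 0) :
    hom K K ≤ ext K K := by
  have hn : Nontrivial (Ext1 K K) := by
    rwa [Ne, ext_eq_zero_iff, not_subsingleton_iff_nontrivial] at h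
  obtain ⟨η, hη⟩ := exists_ne (0 : Ext1 K K)
  obtain ⟨c, rfl⟩ := Submodule.Quotient.mk_surjective _ η
  -- This is `f ↦ f_* η` for a fixed nonzero class `η`. A nonzero `f` is injective, hence
  -- surjective, so `f_*` is a surjective endomorphism of the finite-dimensional `Ext¹(K, K)` and
  -- cannot kill `η`.
  let L : homSpace K K →ₗ[k] Ext1 K K := Submodule.mkQ _ ∘ₗ
    { toFun := fun f i j a => f.1 i ∘ₗ c i j a
      map_add' := fun _ _ => rfl
      map_smul' := fun _ _ => rfl }
  have hL : Function.Injective L := by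
    rw [injective_iff_map_eq_zero]
    intro f hf
    by_contra hf0
    have hfi : ((homEquiv K K).symm f).Inj := hK _ ((Hom.neZero_iff _).2 (by simpa using hf0))
    have hs := ext1Post_surjective K (Hom.surj_of_inj hfi rfl)
    have hi := LinearMap.injective_iff_surjective.2 hs
    exact hη (hi (hf.trans (map_zero _).symm))
  exact LinearMap.finrank_le_finrank_of_injective hL

variable (hQ : IsTame V) {δ : V → ℕ} (hδ : IsMinimalImaginaryRoot δ)
include hQ hδ

/-- Indecomposable modules that are smaller than the minimal imaginary root have no
self-extensions. -/
theorem IsIndecomposable.subsingleton_ext1 {K : Rep k V} [K.FinDim] (hK : K.IsIndecomposable)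
    (hle : K.dimVector ≤ δ) (hne : K.dimVector ≠ δ) : Subsingleton (Ext1 K K) := by
  obtain ⟨n, hn⟩ : ∃ n, K.totalDim = n := ⟨_, rfl⟩
  induction n using Nat.strong_induction_on generalizing K with
  | _ n ih =>
    -- By induction, smaller indecomposables have no self-extensions, so `K` is a brick.
    -- Self-extensions of `K` would then give `⟨K, K⟩ = hom - ext ≤ 0`, against positivity of the
    -- form below `δ`.
    have hb : K.IsBrick := by
      by_contra hb
      obtain ⟨K', h1, h2, h3, h4, h5⟩ := hK.exists_selfExt hb
      refine h5 (ih K'.totalDim ?_ h2 (h3.trans hle) (fun h => ?_) rfl)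
      · rw [← hn]; exact totalDim_lt h3 h4
      · exact hne (le_antisymm hle (h ▸ h3))
    rw [← ext_eq_zero_iff]
    by_contra he
    have h1 := hb.hom_le_ext he
    have h2 := hom_sub_ext K K
    have h3 := hδ.eulerForm_pos hQ (fun h => hK.1 (isZero_iff_dimVector.2 h)) hle hne
    change 0 < eulerForm K.dimInt K.dimInt at h3
    omega

/-- Indecomposable modules of dimension vector `δ` are bricks. -/
theorem IsIndecomposable.isBrick {E : Rep k V} (hE : E.IsIndecomposable) (hd : E.HasDimVector δ) :
    E.IsBrick := by
  have := hd.finDim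
  by_contra hb
  obtain ⟨K, h1, h2, h3, h4, h5⟩ := hE.exists_selfExt hb
  rw [hd.dimVector_eq] at h3 h4
  exact h5 (h2.subsingleton_ext1 hQ hδ h3 h4)

end Brick

/-! ### The defect and the Auslander–Reiten translation -/

section Translate

/-- `Hom(M, φ)`. -/
def homPost (M : Rep k V) {N N' : Rep k V} (φ : Hom N N') : homSpace M N →ₗ[k] homSpace M N' where
  toFun f := homEquiv M N' (φ.comp ((homEquiv M N).symm f))
  map_add' f g := by
    refine Subtype.ext (funext fun i => LinearMap.ext fun x => ?_)
    exact map_add (φ.app i) (f.1 i x) (g.1 i x)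
  map_smul' c f := by
    refine Subtype.ext (funext fun i => LinearMap.ext fun x => ?_)
    exact map_smul (φ.app i) c (f.1 i x)

/-- `Hom(φ, N)`. -/
def homPre {M M' : Rep k V} (φ : Hom M M') (N : Rep k V) : homSpace M' N →ₗ[k] homSpace M N where
  toFun f := homEquiv M N (((homEquiv M' N).symm f).comp φ)
  map_add' _ _ := rfl
  map_smul' _ _ := rfl

/-- The evaluation of homomorphisms at a vector. -/
def homEval (M N : Rep k V) (i : V) (x : M.obj i) : homSpace M N →ₗ[k] N.obj i :=
  LinearMap.applyₗ x ∘ₗ LinearMap.proj i ∘ₗ (homSpace M N).subtype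

section PathFinite

variable [∀ i j : V, Finite (Quiver.Path i j)]

instance (v : V) : (proj k v).FinDim :=
  ⟨fun i => inferInstanceAs (Module.Finite k (Quiver.Path i v →₀ k))⟩

instance (v : V) : (inj k v).FinDim :=
  ⟨fun i => inferInstanceAs (Module.Finite k (Quiver.Path v i → k))⟩

theorem dimInt_proj_apply (v i : V) : (proj k v).dimInt i = Nat.card (Quiver.Path i v) := by
  have := Fintype.ofFinite (Quiver.Path i v)
  change ((Module.finrank k (Quiver.Path i v →₀ k) : ℕ) : ℤ) = _
  rw [Module.finrank_finsupp_self, Nat.card_eq_fintype_card]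

theorem dimInt_inj_apply (v i : V) : (inj k v).dimInt i = Nat.card (Quiver.Path v i) := by
  have := Fintype.ofFinite (Quiver.Path v i)
  change ((Module.finrank k (Quiver.Path v i → k) : ℕ) : ℤ) = _
  rw [Module.finrank_fintype_fun_eq_card, Nat.card_eq_fintype_card]

end PathFinite

variable [Fintype V]

/-- The defect `⟨δ, M⟩` of a module. -/
noncomputable def defect (δ : V → ℕ) (M : Rep k V) : ℤ :=
  eulerForm (fun i => (δ i : ℤ)) M.dimInt

theorem defect_eq_sum (δ : V → ℕ) (M : Rep k V) : defect δ M =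
    ∑ v, (δ v : ℤ) * (M.dimInt v - ∑ i, (Nat.card (i ⟶ v) : ℤ) * M.dimInt i) :=
  eulerForm_eq_sum_left _ _

theorem defect_eq_neg_sum (hQ : IsTame V) {δ : V → ℕ}
    (hδ : IsMinimalImaginaryRoot δ) (M : Rep k V) : defect δ M =
    -∑ v, (δ v : ℤ) * (M.dimInt v - ∑ j, (Nat.card (v ⟶ j) : ℤ) * M.dimInt j) := by
  rw [defect, hδ.swap hQ, eulerForm_eq_sum_right]

/-- Acyclicity provides a vertex of the support that receives no arrow from the support; there the
sum vanishes. -/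
theorem exists_source_of_support (hQ : IsAcyclic V) {M : Rep k V} [M.FinDim] (hM : ¬ M.IsZero) :
    ∃ v, 0 < M.dimInt v - ∑ i, (Nat.card (i ⟶ v) : ℤ) * M.dimInt i := by
  have hne : {v | M.dimInt v ≠ 0}.Nonempty := by
    by_contra h
    rw [Set.not_nonempty_iff_eq_empty, Set.eq_empty_iff_forall_notMem] at h
    exact hM (isZero_iff_dimInt.2 (funext fun v => not_not.1 (h v)))
  obtain ⟨v, hv, hmin⟩ := hQ.wellFounded.has_min _ hne
  refine ⟨v, ?_⟩
  rw [Finset.sum_eq_zero, sub_zero]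
  · exact lt_of_le_of_ne (Int.natCast_nonneg _) (Ne.symm hv)
  · intro i _
    by_cases hi : M.dimInt i = 0
    · rw [hi, mul_zero]
    · have : IsEmpty (i ⟶ v) := not_nonempty_iff.1 (hmin i hi)
      simp

theorem exists_sink_of_support (hQ : IsAcyclic V) {M : Rep k V} [M.FinDim] (hM : ¬ M.IsZero) :
    ∃ v, 0 < M.dimInt v - ∑ j, (Nat.card (v ⟶ j) : ℤ) * M.dimInt j := by
  have hne : {v | M.dimInt v ≠ 0}.Nonempty := by
    by_contra h
    rw [Set.not_nonempty_iff_eq_empty, Set.eq_empty_iff_forall_notMem] at h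
    exact hM (isZero_iff_dimInt.2 (funext fun v => not_not.1 (h v)))
  obtain ⟨v, hv, hmin⟩ := hQ.wellFounded_swap.has_min _ hne
  refine ⟨v, ?_⟩
  rw [Finset.sum_eq_zero, sub_zero]
  · exact lt_of_le_of_ne (Int.natCast_nonneg _) (Ne.symm hv)
  · intro j _
    by_cases hj : M.dimInt j = 0
    · rw [hj, mul_zero]
    · have : IsEmpty (v ⟶ j) := not_nonempty_iff.1 (hmin j hj)
      simp

variable [∀ i j : V, Finite (i ⟶ j)] [∀ i j : V, Finite (Quiver.Path i j)]

instance (M : Rep k V) [M.FinDim] : (tau M).FinDim :=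
  ⟨fun v => inferInstanceAs (Module.Finite k (Module.Dual k (Ext1 M (proj k v))))⟩

instance (M : Rep k V) [M.FinDim] : (tauInv M).FinDim :=
  ⟨fun v => inferInstanceAs (Module.Finite k (Ext1 (inj k v) M))⟩

/-- The shadow on dimension vectors of `0 → ⨁_{j ⟶ v} P_j → P_v → S_v → 0`. -/
theorem dimInt_proj [DecidableEq V] (v : V) : (proj k v).dimInt =
    Pi.single v 1 + ∑ j, (Nat.card (j ⟶ v) : ℤ) • (proj k j).dimInt := by
  funext i
  simp only [Pi.add_apply, Finset.sum_apply, Pi.smul_apply, dimInt_proj_apply, smul_eq_mul]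
  exact card_path_last i v

theorem dimInt_inj [DecidableEq V] (v : V) : (inj k v).dimInt =
    Pi.single v 1 + ∑ j, (Nat.card (v ⟶ j) : ℤ) • (inj k j).dimInt := by
  funext i
  simp only [Pi.add_apply, Finset.sum_apply, Pi.smul_apply, dimInt_inj_apply, smul_eq_mul]
  exact card_path_first v i

theorem dimInt_tau (M : Rep k V) [M.FinDim] (v : V) :
    (tau M).dimInt v = hom M (proj k v) - eulerForm M.dimInt (proj k v).dimInt := by
  rw [← hom_sub_ext]
  have : Module.finrank k (Module.Dual k (Ext1 M (proj k v))) = ext M (proj k v) :=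
    Subspace.dual_finrank_eq
  change ((Module.finrank k (Module.Dual k (Ext1 M (proj k v))) : ℕ) : ℤ) = _
  rw [this]
  ring

theorem dimInt_tauInv (M : Rep k V) [M.FinDim] (v : V) :
    (tauInv M).dimInt v = hom (inj k v) M - eulerForm (inj k v).dimInt M.dimInt := by
  rw [← hom_sub_ext]
  change (ext (inj k v) M : ℤ) = _
  ring

/-- The radical of `P_v` is `⨁ P_j`, over the arrows `j ⟶ v`. -/
theorem sum_hom_proj_le (M : Rep k V) [M.FinDim] (v : V) :
    ∑ j, Nat.card (j ⟶ v) * hom M (proj k j) ≤ hom M (proj k v) := by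
  have := fun i j : V => Fintype.ofFinite (i ⟶ j)
  classical
  let L : (∀ x : Σ j, (j ⟶ v), homSpace M (proj k x.1)) →ₗ[k] homSpace M (proj k v) :=
    ∑ x, homPost M (projMap k x.2) ∘ₗ LinearMap.proj x
  have hL : Function.Injective L := by
    rw [injective_iff_map_eq_zero]
    intro f hf
    refine funext fun x => Subtype.ext (funext fun i => LinearMap.ext fun m => ?_)
    refine Finsupp.ext fun (p : Quiver.Path i x.1) => ?_
    -- The coefficient at `p` followed by the arrow of `x` isolates the component `f x`, since paths
    -- coming from the other components end with a different arrow.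
    let ev : homSpace M (proj k v) →ₗ[k] k :=
      Finsupp.lapply (p.cons x.2) ∘ₗ homEval M (proj k v) i m
    have h1 : ev (L f) = 0 := by rw [hf, map_zero]
    have h2 : ∀ y : Σ j, (j ⟶ v), ev (homPost M (projMap k y.2) (f y)) =
        Finsupp.mapDomain (fun q => q.cons y.2) ((f y).1 i m : Quiver.Path i y.1 →₀ k)
          (p.cons x.2) := fun _ => rfl
    simp only [L, LinearMap.sum_apply, LinearMap.comp_apply, LinearMap.proj_apply, map_sum] at h1
    rw [Finset.sum_congr rfl fun y _ => h2 y, Finset.sum_eq_single x] at h1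
    · exact (Finsupp.mapDomain_apply (f := fun q : Quiver.Path i x.1 => q.cons x.2)
        (fun p q h => by cases h; rfl) _ p).symm.trans h1
    · intro y _ hy
      refine Finsupp.mapDomain_of_notMem_range _ _ ?_
      rintro ⟨q, hq⟩
      cases x
      cases y
      cases hq
      exact hy rfl
    · simp
  have h := LinearMap.finrank_le_finrank_of_injective hL
  rw [Module.finrank_pi_fintype, Fintype.sum_sigma] at h
  refine le_trans (le_of_eq ?_) h
  exact Finset.sum_congr rfl fun j _ => by
    change _ = ∑ _y : (j ⟶ v), hom M (proj k j)
    rw [Finset.sum_const, Finset.card_univ, Nat.card_eq_fintype_card, smul_eq_mul]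

/-- The quotient of `I_v` by its socle is `⨁ I_j`, over the arrows `v ⟶ j`. -/
theorem sum_hom_inj_le (M : Rep k V) [M.FinDim] (v : V) :
    ∑ j, Nat.card (v ⟶ j) * hom (inj k j) M ≤ hom (inj k v) M := by
  have := fun i j : V => Fintype.ofFinite (i ⟶ j)
  classical
  let L : (∀ x : Σ j, (v ⟶ j), homSpace (inj k x.1) M) →ₗ[k] homSpace (inj k v) M :=
    ∑ x, homPre (injMap k x.2) M ∘ₗ LinearMap.proj x
  have hL : Function.Injective L := by
    rw [injective_iff_map_eq_zero]
    intro f hf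
    refine funext fun x => Subtype.ext (funext fun i => LinearMap.ext fun m => ?_)
    -- Extension of `m` by zero to the paths that do not start with the arrow of `x`: the map `I_v →
    -- I_j` of that arrow sends `g` to `m`, and the maps of all other arrows send it to 0.
    let g : Quiver.Path v i → k := Function.extend (fun p => x.2.toPath.comp p) m 0
    let ev : homSpace (inj k v) M →ₗ[k] M.obj i := homEval (inj k v) M i g
    have h1 : ev (L f) = 0 := by rw [hf, map_zero]
    have h2 : ∀ y : Σ j, (v ⟶ j), ev (homPre (injMap k y.2) M (f y)) =
        (f y).1 i ((injMap k y.2).app i g) := fun _ => rfl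
    simp only [L, LinearMap.sum_apply, LinearMap.comp_apply, LinearMap.proj_apply, map_sum] at h1
    rw [Finset.sum_congr rfl fun y _ => h2 y, Finset.sum_eq_single x] at h1
    · have h3 : (injMap k x.2).app i g = m := funext fun p =>
        Function.Injective.extend_apply (Quiver.Path.comp_injective_right _) _ _ p
      rw [h3] at h1
      exact h1
    · intro y _ hy
      have h3 : (injMap k y.2).app i g = 0 := funext fun p => by
        refine Function.extend_apply' _ _ _ ?_
        rintro ⟨q, hq⟩
        have h4 := toPath_comp_inj _ _ _ _ hq
        cases x
        cases y
        cases h4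
        exact hy rfl
      rw [h3, map_zero]
    · simp
  have h := LinearMap.finrank_le_finrank_of_injective hL
  rw [Module.finrank_pi_fintype, Fintype.sum_sigma] at h
  refine le_trans (le_of_eq ?_) h
  exact Finset.sum_congr rfl fun j _ => by
    change _ = ∑ _y : (v ⟶ j), hom (inj k j) M
    rw [Finset.sum_const, Finset.card_univ, Nat.card_eq_fintype_card, smul_eq_mul]

/-- Both sides are `⟨e, dim S_v⟩`, by the projective resolution of `S_v`. -/
theorem eulerForm_proj [DecidableEq V] (e : V → ℤ) (v : V) :
    eulerForm e (proj k v).dimInt - ∑ j, (Nat.card (j ⟶ v) : ℤ) * eulerForm e (proj k j).dimInt =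
      e v - ∑ j, (Nat.card (v ⟶ j) : ℤ) * e j := by
  rw [dimInt_proj, eulerForm_add_right, eulerForm_sum_right, add_sub_cancel_right,
    eulerForm_eq_sum_right]
  simp [Pi.single_apply]

theorem eulerForm_inj [DecidableEq V] (f : V → ℤ) (v : V) :
    eulerForm (inj k v).dimInt f - ∑ j, (Nat.card (v ⟶ j) : ℤ) * eulerForm (inj k j).dimInt f =
      f v - ∑ i, (Nat.card (i ⟶ v) : ℤ) * f i := by
  rw [dimInt_inj, eulerForm_add_left, eulerForm_sum_left, add_sub_cancel_right,
    eulerForm_eq_sum_left]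
  simp [Pi.single_apply]

variable (hQ : IsTame V) {δ : V → ℕ} (hδ : IsMinimalImaginaryRoot δ)
include hQ hδ

/-- Since `dim (τM)_v = hom(M, P_v) - ⟨M, P_v⟩`, the Euler terms contribute `-⟨M, δ⟩ = ⟨δ, M⟩` to
the defect of `τM`. The `hom` terms contribute a nonnegative amount because `⨁_{j ⟶ v} P_j` embeds
in `P_v`. -/
theorem defect_le_defect_tau (M : Rep k V) [M.FinDim] : defect δ M ≤ defect δ (tau M) := by
  classical
  rw [defect_eq_sum δ (tau M), defect_eq_neg_sum hQ hδ,
    ← Finset.sum_neg_distrib]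
  refine Finset.sum_le_sum fun v _ => ?_
  have h1 : (∑ j, (Nat.card (j ⟶ v) : ℤ) * hom M (proj k j)) ≤ hom M (proj k v) := by
    exact_mod_cast sum_hom_proj_le M v
  have h2 := eulerForm_proj (k := k) M.dimInt v
  simp only [dimInt_tau, mul_sub, Finset.sum_sub_distrib]
  nlinarith [mul_le_mul_of_nonneg_left h1 (Int.natCast_nonneg (δ v)),
    congrArg (fun t => (δ v : ℤ) * t) h2]

/-- If `τM = 0`, then `⟨M, P_v⟩ = hom(M, P_v)` for all `v`, so `⟨M, S_v⟩ ≥ 0`, strictly at a sink of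
the support. Weighting by the positive numbers `δ v` gives `⟨M, δ⟩ > 0`. -/
theorem defect_neg_of_tau_isZero {M : Rep k V} [M.FinDim] (hM : ¬ M.IsZero)
    (h : (tau M).IsZero) : defect δ M < 0 := by
  classical
  rw [defect_eq_neg_sum hQ hδ, neg_lt_zero]
  have hv : ∀ v, 0 ≤ M.dimInt v - ∑ j, (Nat.card (v ⟶ j) : ℤ) * M.dimInt j := by
    intro v
    have h0 : ∀ v, eulerForm M.dimInt (proj k v).dimInt = hom M (proj k v) := fun v => by
      have h1 := dimInt_tau M v
      rw [isZero_iff_dimInt.1 h, Pi.zero_apply] at h1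
      linarith
    have h1 : (∑ j, (Nat.card (j ⟶ v) : ℤ) * hom M (proj k j)) ≤ hom M (proj k v) := by
      exact_mod_cast sum_hom_proj_le M v
    rw [← eulerForm_proj (k := k) M.dimInt v]
    simp only [h0]
    linarith
  obtain ⟨v, hv'⟩ := exists_sink_of_support hQ.1 hM
  exact Finset.sum_pos' (fun v _ => mul_nonneg (Int.natCast_nonneg _) (hv v))
    ⟨v, Finset.mem_univ _, mul_pos (by exact_mod_cast hδ.pos hQ v) hv'⟩

/-- Dual to `defect_le_defect_tau`, with the quotient of `I_v` by its socle in place of the radical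
of `P_v`. -/
theorem defect_tauInv_le_defect (M : Rep k V) [M.FinDim] : defect δ (tauInv M) ≤ defect δ M := by
  classical
  rw [defect_eq_sum δ M, defect_eq_neg_sum hQ hδ,
    ← Finset.sum_neg_distrib]
  refine Finset.sum_le_sum fun v _ => ?_
  have h1 : (∑ j, (Nat.card (v ⟶ j) : ℤ) * hom (inj k j) M) ≤ hom (inj k v) M := by
    exact_mod_cast sum_hom_inj_le M v
  have h2 := eulerForm_inj (k := k) M.dimInt v
  simp only [dimInt_tauInv, mul_sub, Finset.sum_sub_distrib]
  nlinarith [mul_le_mul_of_nonneg_left h1 (Int.natCast_nonneg (δ v)),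
    congrArg (fun t => (δ v : ℤ) * t) h2]

theorem defect_pos_of_tauInv_isZero {M : Rep k V} [M.FinDim] (hM : ¬ M.IsZero)
    (h : (tauInv M).IsZero) : 0 < defect δ M := by
  classical
  rw [defect_eq_sum]
  have hv : ∀ v, 0 ≤ M.dimInt v - ∑ i, (Nat.card (i ⟶ v) : ℤ) * M.dimInt i := by
    intro v
    have h0 : ∀ v, eulerForm (inj k v).dimInt M.dimInt = hom (inj k v) M := fun v => by
      have h1 := dimInt_tauInv M v
      rw [isZero_iff_dimInt.1 h, Pi.zero_apply] at h1
      linarith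
    have h1 : (∑ j, (Nat.card (v ⟶ j) : ℤ) * hom (inj k j) M) ≤ hom (inj k v) M := by
      exact_mod_cast sum_hom_inj_le M v
    rw [← eulerForm_inj (k := k) M.dimInt v]
    simp only [h0]
    linarith
  obtain ⟨v, hv'⟩ := exists_source_of_support hQ.1 hM
  exact Finset.sum_pos' (fun v _ => mul_nonneg (Int.natCast_nonneg _) (hv v))
    ⟨v, Finset.mem_univ _, mul_pos (by exact_mod_cast hδ.pos hQ v) hv'⟩

/-- Modules annihilated by a power of `τ` have negative defect. -/
theorem defect_neg_of_iterate_tau {M : Rep k V} [M.FinDim] (hM : ¬ M.IsZero) {m : ℕ}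
    (h : (tau^[m] M).IsZero) : defect δ M < 0 := by
  induction m generalizing M with
  | zero => exact absurd h hM
  | succ m ih =>
    by_cases hz : (tau M).IsZero
    · exact defect_neg_of_tau_isZero hQ hδ hM hz
    · exact (defect_le_defect_tau hQ hδ M).trans_lt (ih hz h)

/-- Modules annihilated by a power of `τ⁻` have positive defect. -/
theorem defect_pos_of_iterate_tauInv {M : Rep k V} [M.FinDim] (hM : ¬ M.IsZero) {m : ℕ}
    (h : (tauInv^[m] M).IsZero) : 0 < defect δ M := by
  induction m generalizing M with
  | zero => exact absurd h hM
  | succ m ih =>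
    by_cases hz : (tauInv M).IsZero
    · exact defect_pos_of_tauInv_isZero hQ hδ hM hz
    · exact (ih hz h).trans_le (defect_tauInv_le_defect hQ hδ M)

end Translate

end Rep

end TameQuiver

namespace TameQuiver

namespace Rep

variable {k : Type u} [Field k] {V : Type} [Quiver.{0} V]

/-! ### Stability of regular simple modules -/

section Stable

variable [Fintype V]

theorem HasDimVector.defect_eq {E : Rep k V} {δ : V → ℕ} (hd : E.HasDimVector δ) (M : Rep k V) :
    defect δ M = eulerForm E.dimInt M.dimInt := by
  rw [hd.dimInt_eq]; rfl

theorem defect_ker_add_range (δ : V → ℕ) {M N : Rep k V} [M.FinDim] (f : Hom M N) :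
    defect δ f.ker.toRep + defect δ f.range.toRep = defect δ M := by
  simp only [defect]
  rw [← eulerForm_add_right, f.dimInt_ker_add_range]

/-- Stable bricks of dimension vector `δ`. -/
structure IsStable (δ : V → ℕ) (E : Rep k V) : Prop where
  hasDimVector : E.HasDimVector δ
  isBrick : E.IsBrick
  defect_neg : ∀ U : Sub E, U.carrier ≠ ⊥ → U.carrier ≠ ⊤ → defect δ U.toRep < 0

variable [∀ i j : V, Finite (i ⟶ j)]

/-- A brick of dimension vector `δ` has no nonzero maps to proper submodules, so that their
defects are not positive. -/
theorem IsBrick.defect_nonpos {δ : V → ℕ} {E X : Rep k V} (hE : E.IsBrick)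
    (hd : E.HasDimVector δ) [X.FinDim] {f : Hom X E} (hf : f.Inj) (hne : X.dimVector ≠ δ) :
    defect δ X ≤ 0 := by
  have := hd.finDim
  by_contra! h
  rw [hd.defect_eq, ← hom_sub_ext] at h
  obtain ⟨g, i, x, hx⟩ := exists_hom_of_pos (M := E) (N := X) (by omega)
  have hg : (f.comp g).Inj := hE _ ⟨i, x, fun h0 => hx (hf i (h0.trans (map_zero _).symm))⟩
  have hg' : g.Inj := fun i x y hxy => hg i (congrArg (f.app i) hxy)
  rw [← hd.dimVector_eq] at hne
  exact hne (le_antisymm (dimVector_le_of_inj hf) (dimVector_le_of_inj hg'))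

/-- Suppose a proper nonzero submodule has defect zero. Its direct summands are proper submodules of
the brick `E`, so their defects are nonpositive, and they add up to zero. Hence no summand is
preprojective or preinjective, and the submodule is regular, contrary to regular simplicity. -/
theorem IsRegularSimple.isStable (hQ : IsTame V) {δ : V → ℕ} (hδ : IsMinimalImaginaryRoot δ)
    {E : Rep k V} (hE : E.IsRegularSimple) (hd : E.HasDimVector δ) : E.IsStable δ := by
  have hb := hE.1.isBrick hQ hδ hd
  have := hd.finDim
  have := hQ.1.finite_path
  refine ⟨hd, hb, fun U h0 h1 => ?_⟩
  have hne : U.toRep.dimVector ≠ δ := fun h =>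
    h1 (U.eq_top_of_dimVector (h.trans hd.dimVector_eq.symm))
  refine lt_of_le_of_ne (hb.defect_nonpos hd U.incl_inj hne) fun hU => ?_
  have hsub : ∀ A : Sub U.toRep, defect δ A.toRep ≤ 0 := fun A => by
    refine hb.defect_nonpos hd (f := U.incl.comp A.incl)
      (fun i => (U.incl_inj i).comp (A.incl_inj i)) fun h => hne ?_
    exact le_antisymm (hd.dimVector_eq ▸ U.dimVector_le) (h ▸ A.dimVector_le)
  refine (hE.2.2 U fun A B hAB hA => ?_).elim h0 h1
  have h2 : defect δ A.toRep + defect δ B.toRep = 0 := by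
    rw [← hU]
    simp only [defect]
    rw [← eulerForm_add_right, A.dimInt_add B hAB]
  have hA1 := hsub A
  have hB1 := hsub B
  constructor
  · rintro ⟨-, m, hm⟩
    have := defect_neg_of_iterate_tau hQ hδ hA.1 hm
    omega
  · rintro ⟨-, m, hm⟩
    have := defect_pos_of_iterate_tauInv hQ hδ hA.1 hm
    omega

end Stable

/-! ### Cochains supported at one arrow -/

section Cochains

/-- The cochains whose classes form `Ext¹(M, N)`. -/
abbrev Cochain (M N : Rep k V) : Type u := ∀ i j : V, (i ⟶ j) → (M.obj j →ₗ[k] N.obj i)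

open Classical in
/-- The cochain with one component. -/
noncomputable def cochainAt (M N : Rep k V) {i j : V} (a : i ⟶ j) :
    (M.obj j →ₗ[k] N.obj i) →ₗ[k] Cochain M N :=
  LinearMap.single k (fun i => ∀ j : V, (i ⟶ j) → (M.obj j →ₗ[k] N.obj i)) i ∘ₗ
    LinearMap.single k (fun j => (i ⟶ j) → (M.obj j →ₗ[k] N.obj i)) j ∘ₗ
      LinearMap.single k (fun _ : i ⟶ j => M.obj j →ₗ[k] N.obj i) a

/-- The extension class given by an arrow, a linear form and a vector. -/
noncomputable def arrowExt (M N : Rep k V) {i j : V} (a : i ⟶ j) (ξ : Module.Dual k (M.obj j))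
    (n : N.obj i) : Ext1 M N :=
  Submodule.mkQ _ (cochainAt M N a (ξ.smulRight n))

theorem comp_cochainAt (M : Rep k V) {N N' : Rep k V} (φ : ∀ i, N.obj i →ₗ[k] N'.obj i) {i j : V}
    (a : i ⟶ j) (f : M.obj j →ₗ[k] N.obj i) :
    (fun i' j' a' => φ i' ∘ₗ cochainAt M N a f i' j' a') = cochainAt M N' a (φ i ∘ₗ f) := by
  classical
  funext i' j' a'
  simp only [cochainAt, LinearMap.comp_apply, LinearMap.single_apply]
  by_cases hi : i' = i
  · subst hi
    rw [Pi.single_eq_same, Pi.single_eq_same]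
    by_cases hj : j' = j
    · subst hj
      rw [Pi.single_eq_same, Pi.single_eq_same]
      by_cases ha : a' = a
      · subst ha
        rw [Pi.single_eq_same, Pi.single_eq_same]
      · rw [Pi.single_eq_of_ne ha, Pi.single_eq_of_ne ha, LinearMap.comp_zero]
    · rw [Pi.single_eq_of_ne hj, Pi.single_eq_of_ne hj]
      exact LinearMap.comp_zero _
  · rw [Pi.single_eq_of_ne hi, Pi.single_eq_of_ne hi]
    exact LinearMap.comp_zero _

theorem ext1Post_arrowExt (M : Rep k V) {N N' : Rep k V} (φ : Hom N N') {i j : V} (a : i ⟶ j)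
    (ξ : Module.Dual k (M.obj j)) (n : N.obj i) :
    ext1Post M φ (arrowExt M N a ξ n) = arrowExt M N' a ξ (φ.app i n) := by
  have h := comp_cochainAt M φ.app a (ξ.smulRight n)
  have h' : φ.app i ∘ₗ ξ.smulRight n = ξ.smulRight (φ.app i n) :=
    LinearMap.ext fun x => (φ.app i).map_smul (ξ x) n
  rw [h'] at h
  exact congrArg (Submodule.mkQ _) h

theorem arrowExt_add (M N : Rep k V) {i j : V} (a : i ⟶ j) (ξ : Module.Dual k (M.obj j))
    (n n' : N.obj i) : arrowExt M N a ξ (n + n') = arrowExt M N a ξ n + arrowExt M N a ξ n' := by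
  have h : ξ.smulRight (n + n') = ξ.smulRight n + ξ.smulRight n' :=
    LinearMap.ext fun x => smul_add _ _ _
  rw [arrowExt, h, map_add, map_add]
  rfl

theorem arrowExt_smul (M N : Rep k V) {i j : V} (a : i ⟶ j) (ξ : Module.Dual k (M.obj j))
    (c : k) (n : N.obj i) : arrowExt M N a ξ (c • n) = c • arrowExt M N a ξ n := by
  have h : ξ.smulRight (c • n) = c • ξ.smulRight n :=
    LinearMap.ext fun x => smul_comm _ _ _
  rw [arrowExt, h, map_smul, map_smul]
  rfl

theorem arrowExt_add_left (M N : Rep k V) {i j : V} (a : i ⟶ j) (ξ ξ' : Module.Dual k (M.obj j))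
    (n : N.obj i) : arrowExt M N a (ξ + ξ') n = arrowExt M N a ξ n + arrowExt M N a ξ' n := by
  have h : (ξ + ξ').smulRight n = ξ.smulRight n + ξ'.smulRight n :=
    LinearMap.ext fun x => add_smul _ _ _
  rw [arrowExt, h, map_add, map_add]
  rfl

theorem arrowExt_smul_left (M N : Rep k V) {i j : V} (a : i ⟶ j) (c : k)
    (ξ : Module.Dual k (M.obj j)) (n : N.obj i) :
    arrowExt M N a (c • ξ) n = c • arrowExt M N a ξ n := by
  have h : (c • ξ).smulRight n = c • ξ.smulRight n :=
    LinearMap.ext fun x => mul_smul _ _ _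
  rw [arrowExt, h, map_smul, map_smul]
  rfl

theorem linearMap_ext_smulRight {X Y Z : Type*} [AddCommGroup X] [Module k X] [AddCommGroup Y]
    [Module k Y] [AddCommGroup Z] [Module k Z] [Module.Finite k X] {f g : (X →ₗ[k] Y) →ₗ[k] Z}
    (h : ∀ (ξ : Module.Dual k X) (y : Y), f (ξ.smulRight y) = g (ξ.smulRight y)) : f = g := by
  have h1 : f ∘ₗ (dualTensorHomEquiv k X Y).toLinearMap =
      g ∘ₗ (dualTensorHomEquiv k X Y).toLinearMap := by
    refine TensorProduct.ext' fun ξ y => ?_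
    have : dualTensorHomEquiv k X Y (ξ ⊗ₜ y) = ξ.smulRight y := LinearMap.ext fun x => by simp
    simp only [LinearMap.comp_apply, LinearEquiv.coe_coe, this, h]
  refine LinearMap.ext fun t => ?_
  have h2 := LinearMap.congr_fun h1 ((dualTensorHomEquiv k X Y).symm t)
  simpa using h2

theorem exists_linearMap_smulRight {X Y Z : Type*} [AddCommGroup X] [Module k X] [AddCommGroup Y]
    [Module k Y] [AddCommGroup Z] [Module k Z] [Module.Finite k X]
    (B : Module.Dual k X →ₗ[k] Y →ₗ[k] Z) :
    ∃ f : (X →ₗ[k] Y) →ₗ[k] Z, ∀ ξ y, f (ξ.smulRight y) = B ξ y := by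
  refine ⟨TensorProduct.lift B ∘ₗ (dualTensorHomEquiv k X Y).symm.toLinearMap, fun ξ y => ?_⟩
  have : dualTensorHomEquiv k X Y (ξ ⊗ₜ y) = ξ.smulRight y := LinearMap.ext fun x => by simp
  simp [← this]

variable [Fintype V]

theorem sum_cochainAt [∀ i j : V, Fintype (i ⟶ j)] {M N : Rep k V} (c : Cochain M N) :
    ∑ i, ∑ j, ∑ a : i ⟶ j, cochainAt M N a (c i j a) = c := by
  classical
  have h1 : ∀ i j, ∑ a : i ⟶ j, cochainAt M N a (c i j a) =
      LinearMap.single k (fun i => ∀ j : V, (i ⟶ j) → (M.obj j →ₗ[k] N.obj i)) i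
        (LinearMap.single k (fun j => (i ⟶ j) → (M.obj j →ₗ[k] N.obj i)) j (c i j)) := by
    intro i j
    conv_rhs => rw [← Finset.univ_sum_single (c i j)]
    rw [map_sum, map_sum]
    rfl
  have h2 : ∀ i, ∑ j, ∑ a : i ⟶ j, cochainAt M N a (c i j a) =
      LinearMap.single k (fun i => ∀ j : V, (i ⟶ j) → (M.obj j →ₗ[k] N.obj i)) i (c i) := by
    intro i
    conv_rhs => rw [← Finset.univ_sum_single (c i)]
    rw [map_sum]
    exact Finset.sum_congr rfl fun j _ => h1 i j
  conv_rhs => rw [← Finset.univ_sum_single c]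
  exact Finset.sum_congr rfl fun i _ => h2 i

/-- The classes `arrowExt` span `Ext¹`: a cochain is a sum of cochains at single arrows, and
rank-one maps span the linear maps out of the finite-dimensional `M_j`. -/
theorem ext1_linearMap_ext [∀ i j : V, Finite (i ⟶ j)] {M N : Rep k V} [M.FinDim] {Z : Type*} [AddCommGroup Z] [Module k Z]
    {f g : Ext1 M N →ₗ[k] Z}
    (h : ∀ (i j : V) (a : i ⟶ j) ξ n, f (arrowExt M N a ξ n) = g (arrowExt M N a ξ n)) :
    f = g := by
  classical
  refine Submodule.linearMap_qext _ ?_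
  refine LinearMap.pi_ext' fun i => LinearMap.pi_ext' fun j => LinearMap.pi_ext' fun a => ?_
  refine linearMap_ext_smulRight fun ξ n => ?_
  exact h i j a ξ n

end Cochains

end Rep

end TameQuiver

namespace TameQuiver

namespace Rep

variable {k : Type u} [Field k] {V : Type} [Quiver.{0} V]

/-! ### Projective modules -/

section Projective

/-- The action of a path. -/
def mapPath (M : Rep k V) {i : V} : ∀ {v : V}, Quiver.Path i v → (M.obj v →ₗ[k] M.obj i)
  | _, .nil => LinearMap.id
  | _, .cons p a => mapPath M p ∘ₗ M.map a

theorem mapPath_toPath_comp (M : Rep k V) {i j v : V} (a : i ⟶ j) (p : Quiver.Path j v) :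
    M.mapPath (a.toPath.comp p) = M.map a ∘ₗ M.mapPath p := by
  induction p with
  | nil => rfl
  | cons q c ih =>
    rw [Quiver.Path.comp_cons, mapPath, ih, LinearMap.comp_assoc]
    rfl

/-- The homomorphism `P_v → M` given by a vector of `M_v`. -/
noncomputable def ofVector (M : Rep k V) {v : V} (m : M.obj v) : Hom (proj k v) M where
  app _ := Finsupp.linearCombination k fun p => M.mapPath p m
  comm {i j} a := by
    refine Finsupp.lhom_ext fun p c => ?_
    change Finsupp.linearCombination k (fun p => M.mapPath p m)
        (Finsupp.mapDomain (fun p => a.toPath.comp p) (Finsupp.single p c)) =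
      M.map a (Finsupp.linearCombination k (fun p => M.mapPath p m) (Finsupp.single p c))
    rw [Finsupp.mapDomain_single, Finsupp.linearCombination_single,
      Finsupp.linearCombination_single, mapPath_toPath_comp, map_smul]
    rfl

/-- The basis of `P_v` given by the paths. -/
noncomputable def projBasis {i v : V} (p : Quiver.Path i v) : (proj k v).obj i :=
  Finsupp.single p (1 : k)

theorem proj_linearMap_ext {i v : V} {X : Type*} [AddCommGroup X] [Module k X]
    {f g : (proj k v).obj i →ₗ[k] X} (h : ∀ p, f (projBasis p) = g (projBasis p)) : f = g :=
  Finsupp.lhom_ext' fun p => LinearMap.ext_ring (h p)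

theorem ofVector_projBasis (M : Rep k V) {i v : V} (m : M.obj v) (p : Quiver.Path i v) :
    (M.ofVector m).app i (projBasis p) = M.mapPath p m := by
  change Finsupp.linearCombination k (fun p => M.mapPath p m) (Finsupp.single p 1) = _
  rw [Finsupp.linearCombination_single, one_smul]

theorem projMap_projBasis {i v w : V} (b : v ⟶ w) (p : Quiver.Path i v) :
    (projMap k b).app i (projBasis p) = projBasis (p.cons b) :=
  Finsupp.mapDomain_single

theorem proj_map_projBasis {i j v : V} (a : i ⟶ j) (p : Quiver.Path j v) :
    (proj k v).map a (projBasis p) = projBasis (a.toPath.comp p) :=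
  Finsupp.mapDomain_single

theorem hom_proj_ext {M : Rep k V} {v : V} {f g : Hom (proj k v) M}
    (h : f.app v (projBasis Quiver.Path.nil) = g.app v (projBasis Quiver.Path.nil)) (i : V) :
    f.app i = g.app i := by
  have key : ∀ n i (p : Quiver.Path i v), p.length = n →
      f.app i (projBasis p) = g.app i (projBasis p) := by
    intro n
    induction n with
    | zero =>
      intro i p hp
      obtain rfl := Quiver.Path.eq_of_length_zero p hp
      rw [Quiver.Path.eq_nil_of_length_zero p hp]
      exact h
    | succ n ih =>
      intro i p hp
      obtain ⟨j, a, q, hpq, hq⟩ := Quiver.Path.eq_toPath_comp_of_length_eq_succ p hp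
      rw [hq, ← proj_map_projBasis, f.comm_apply, g.comm_apply, ih j q hpq]
  exact proj_linearMap_ext fun p => key _ i p rfl

variable [Fintype V] [∀ i j : V, Finite (i ⟶ j)] [∀ i j : V, Finite (Quiver.Path i j)]

/-- Sorting the paths that end at `v` by their first arrow leaves only the trivial path. -/
theorem eulerForm_proj_left (f : V → ℤ) (v : V) : eulerForm (proj k v).dimInt f = f v := by
  classical
  rw [eulerForm_eq_sum_right, Finset.sum_eq_single v]
  · simp only [dimInt_proj_apply]
    rw [card_path_first v v]
    simp
  · intro i _ hi
    simp only [dimInt_proj_apply]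
    rw [card_path_first i v]
    simp [Pi.single_eq_of_ne hi.symm]
  · simp

/-- A homomorphism from `P_v` is determined by its value at the trivial path, so `hom ≤ dim M_v =
⟨P_v, M⟩ = hom - ext`. -/
theorem ext_proj_eq_zero (M : Rep k V) [M.FinDim] (v : V) : ext (proj k v) M = 0 := by
  have hL : Function.Injective (homEval (proj k v) M v (projBasis Quiver.Path.nil)) := by
    intro f g h
    exact Subtype.ext (funext fun i => hom_proj_ext
      (f := (homEquiv _ _).symm f) (g := (homEquiv _ _).symm g) h i)
  have h1 : hom (proj k v) M ≤ M.dimVector v := LinearMap.finrank_le_finrank_of_injective hL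
  have h2 := hom_sub_ext (proj k v) M
  rw [eulerForm_proj_left] at h2
  have h3 : M.dimInt v = M.dimVector v := rfl
  omega

/-- Submodules of `P_v` have no extensions. -/
theorem ext_eq_zero_of_inj_proj {X : Rep k V} [X.FinDim] {v : V} {f : Hom X (proj k v)}
    (hf : f.Inj) (M : Rep k V) [M.FinDim] : ext X M = 0 := by
  have h := (ext_eq_zero_iff _ _).1 (ext_proj_eq_zero (k := k) M v)
  rw [ext_eq_zero_iff]
  exact (ext1Pre_surjective hf M).subsingleton

end Projective

/-! ### Auslander–Reiten duality -/

section Duality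

theorem ofVector_map (M : Rep k V) {v w : V} (b : v ⟶ w) (m : M.obj w) (i : V) :
    (M.ofVector (M.map b m)).app i = ((M.ofVector m).comp (projMap k b)).app i := by
  refine proj_linearMap_ext fun p => ?_
  rw [ofVector_projBasis, Hom.comp_app, projMap_projBasis, ofVector_projBasis]
  rfl

theorem ofVector_add (M : Rep k V) {v : V} (m m' : M.obj v) (i : V) :
    (M.ofVector (m + m')).app i = (M.ofVector m).app i + (M.ofVector m').app i := by
  refine proj_linearMap_ext fun p => ?_
  rw [LinearMap.add_apply, ofVector_projBasis, ofVector_projBasis, ofVector_projBasis, map_add]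

theorem ofVector_smul (M : Rep k V) {v : V} (c : k) (m : M.obj v) (i : V) :
    (M.ofVector (c • m)).app i = c • (M.ofVector m).app i := by
  refine proj_linearMap_ext fun p => ?_
  rw [LinearMap.smul_apply, ofVector_projBasis, ofVector_projBasis, map_smul]

theorem ext1Post_add (M : Rep k V) {N N' : Rep k V} {φ φ₁ φ₂ : Hom N N'}
    (h : ∀ i, φ.app i = φ₁.app i + φ₂.app i) (z : Ext1 M N) :
    ext1Post M φ z = ext1Post M φ₁ z + ext1Post M φ₂ z := by
  obtain ⟨c, rfl⟩ := Submodule.Quotient.mk_surjective _ z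
  refine congrArg Submodule.Quotient.mk (funext fun i => funext fun j => funext fun a => ?_)
  change φ.app i ∘ₗ c i j a = φ₁.app i ∘ₗ c i j a + φ₂.app i ∘ₗ c i j a
  rw [h, LinearMap.add_comp]

theorem ext1Post_smul (M : Rep k V) {N N' : Rep k V} {φ φ₁ : Hom N N'} {r : k}
    (h : ∀ i, φ.app i = r • φ₁.app i) (z : Ext1 M N) :
    ext1Post M φ z = r • ext1Post M φ₁ z := by
  obtain ⟨c, rfl⟩ := Submodule.Quotient.mk_surjective _ z
  refine congrArg Submodule.Quotient.mk (funext fun i => funext fun j => funext fun a => ?_)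
  change φ.app i ∘ₗ c i j a = r • (φ₁.app i ∘ₗ c i j a)
  rw [h, LinearMap.smul_comp]

theorem ext1Pre_add {M M' : Rep k V} {φ φ₁ φ₂ : Hom M M'} (h : ∀ i, φ.app i = φ₁.app i + φ₂.app i)
    (N : Rep k V) (z : Ext1 M' N) : ext1Pre φ N z = ext1Pre φ₁ N z + ext1Pre φ₂ N z := by
  obtain ⟨c, rfl⟩ := Submodule.Quotient.mk_surjective _ z
  refine congrArg Submodule.Quotient.mk (funext fun i => funext fun j => funext fun a => ?_)
  change c i j a ∘ₗ φ.app j = c i j a ∘ₗ φ₁.app j + c i j a ∘ₗ φ₂.app j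
  rw [h, LinearMap.comp_add]

theorem ext1Pre_smul {M M' : Rep k V} {φ φ₁ : Hom M M'} {r : k} (h : ∀ i, φ.app i = r • φ₁.app i)
    (N : Rep k V) (z : Ext1 M' N) : ext1Pre φ N z = r • ext1Pre φ₁ N z := by
  obtain ⟨c, rfl⟩ := Submodule.Quotient.mk_surjective _ z
  refine congrArg Submodule.Quotient.mk (funext fun i => funext fun j => funext fun a => ?_)
  change c i j a ∘ₗ φ.app j = r • (c i j a ∘ₗ φ₁.app j)
  rw [h, LinearMap.comp_smul]

theorem ext1Post_comp (M : Rep k V) {N N' N'' : Rep k V} {φ : Hom N N''} {ψ : Hom N' N''}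
    {χ : Hom N N'} (h : ∀ i, φ.app i = (ψ.comp χ).app i) (z : Ext1 M N) :
    ext1Post M φ z = ext1Post M ψ (ext1Post M χ z) := by
  obtain ⟨c, rfl⟩ := Submodule.Quotient.mk_surjective _ z
  refine congrArg Submodule.Quotient.mk (funext fun i => funext fun j => funext fun a => ?_)
  change φ.app i ∘ₗ c i j a = ψ.app i ∘ₗ χ.app i ∘ₗ c i j a
  rw [h]
  rfl

/-- The homomorphism `M → τ U` given by a linear form on `Ext¹(U, M)`. -/
noncomputable def homTauOfDual (U M : Rep k V) (φ : Module.Dual k (Ext1 U M)) :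
    Hom M (tau U) where
  app v :=
    { toFun := fun m => (φ ∘ₗ ext1Post U (M.ofVector m) : Module.Dual k (Ext1 U (proj k v)))
      map_add' := fun m m' => LinearMap.ext fun z => by
        change φ _ = φ _ + φ _
        rw [ext1Post_add U (M.ofVector_add m m'), map_add]
      map_smul' := fun c m => LinearMap.ext fun z => by
        change φ _ = c • φ _
        rw [ext1Post_smul U (M.ofVector_smul c m), map_smul] }
  comm {v w} b := LinearMap.ext fun m => LinearMap.ext fun z =>
    congrArg φ (ext1Post_comp U (M.ofVector_map b m) z)

/-- The value of a homomorphism `M → τ U`. -/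
noncomputable def tauValue {U M : Rep k V} (g : Hom M (tau U)) {v : V} (m : M.obj v) :
    Module.Dual k (Ext1 U (proj k v)) := g.app v m

theorem tauValue_map {U M : Rep k V} (g : Hom M (tau U)) {v w : V} (b : v ⟶ w) (m : M.obj w)
    (z : Ext1 U (proj k v)) :
    tauValue g (M.map b m) z = tauValue g m (ext1Post U (projMap k b) z) :=
  LinearMap.congr_fun (g.comm_apply b m) z

/-- `τ` of a homomorphism. -/
noncomputable def tauMap {M N : Rep k V} (f : Hom M N) : Hom (tau M) (tau N) where
  app v := (ext1Pre f (proj k v)).dualMap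
  comm {v w} b := by
    refine LinearMap.ext fun φ => LinearMap.ext fun z => ?_
    obtain ⟨c, rfl⟩ := Submodule.Quotient.mk_surjective _ z
    rfl

theorem tauMap_inj {M N : Rep k V} {f : Hom M N} (hf : f.Inj) : (tauMap f).Inj :=
  fun v => LinearMap.dualMap_injective_of_surjective (ext1Pre_surjective hf (proj k v))

variable [Fintype V] [∀ i j : V, Finite (i ⟶ j)]

/-- A linear form `φ` is recovered from `homTauOfDual`: its value at the class of `a`, `ξ`, `n` is
that of the image of `n` at the class of `a`, `ξ` and the trivial path of `P_i`. -/
theorem exists_hom_tau {U M : Rep k V} [U.FinDim] [M.FinDim] (h : ext U M ≠ 0) :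
    ∃ g : Hom M (tau U), g.NeZero := by
  have : Nontrivial (Ext1 U M) := by
    rwa [Ne, ext_eq_zero_iff, not_subsingleton_iff_nontrivial] at h
  obtain ⟨φ, hφ⟩ := exists_ne (0 : Module.Dual k (Ext1 U M))
  refine ⟨homTauOfDual U M φ, ?_⟩
  by_contra hg
  simp only [Hom.NeZero, not_exists, not_not] at hg
  refine hφ (ext1_linearMap_ext fun i j a ξ n => ?_)
  have h1 := LinearMap.congr_fun (hg i n) (arrowExt U (proj k i) a ξ (projBasis Quiver.Path.nil))
  change φ (ext1Post U (M.ofVector n) _) = 0 at h1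
  rw [ext1Post_arrowExt, ofVector_projBasis] at h1
  exact h1

/-- Compatibility with the arrows moves the last arrow of a path in `P_v` onto the vector `m`, so
the values at trivial paths determine `g`. -/
theorem tauValue_eq_zero {U M : Rep k V} [U.FinDim] {g : Hom M (tau U)}
    (h : ∀ (i j : V) (a : i ⟶ j) ξ m,
      tauValue g m (arrowExt U (proj k i) a ξ (projBasis Quiver.Path.nil)) = 0)
    {v : V} (m : M.obj v) : tauValue g m = 0 := by
  have key : ∀ (i j : V) (a : i ⟶ j) ξ v (p : Quiver.Path i v) (m : M.obj v),
      tauValue g m (arrowExt U (proj k v) a ξ (projBasis p)) = 0 := by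
    intro i j a ξ v p
    induction p with
    | nil => exact h i j a ξ
    | cons p b ih =>
      intro m
      rw [← projMap_projBasis, ← ext1Post_arrowExt, ← tauValue_map]
      exact ih _
  refine ext1_linearMap_ext fun i j a ξ n => ?_
  let L : (proj k v).obj i →ₗ[k] k :=
    { toFun := fun n => tauValue g m (arrowExt U (proj k v) a ξ n)
      map_add' := fun n n' => by rw [arrowExt_add, map_add]
      map_smul' := fun c n => by rw [arrowExt_smul, map_smul]; rfl }
  have hL : L = 0 := proj_linearMap_ext fun p => key i j a ξ v p m
  exact LinearMap.congr_fun hL n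

/-- The inverse of `homTauOfDual`: the prescribed values are bilinear in `ξ` and `m`, hence define a
form on cochains, and it remains to see that coboundaries are killed. -/
theorem exists_dual_of_hom_tau {U M : Rep k V} [U.FinDim] (g : Hom M (tau U)) :
    ∃ φ : Module.Dual k (Ext1 U M), ∀ (i j : V) (a : i ⟶ j) ξ (m : M.obj i),
      φ (arrowExt U M a ξ m) =
        tauValue g m (arrowExt U (proj k i) a ξ (projBasis Quiver.Path.nil)) := by
  classical
  have := fun i j : V => Fintype.ofFinite (i ⟶ j)
  have hT : ∀ (i j : V) (a : i ⟶ j), ∃ T : (U.obj j →ₗ[k] M.obj i) →ₗ[k] k, ∀ ξ m,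
      T (LinearMap.smulRight ξ m) =
        tauValue g m (arrowExt U (proj k i) a ξ (projBasis Quiver.Path.nil)) := by
    intro i j a
    refine exists_linearMap_smulRight (LinearMap.mk₂ k (fun ξ m =>
      tauValue g m (arrowExt U (proj k i) a ξ (projBasis Quiver.Path.nil))) ?_ ?_ ?_ ?_)
    · intro ξ ξ' m
      rw [arrowExt_add_left, map_add]
    · intro c ξ m
      rw [arrowExt_smul_left, map_smul]
    · intro ξ m m'
      exact LinearMap.congr_fun (map_add (g.app i) m m') _
    · intro c ξ m
      exact LinearMap.congr_fun (map_smul (g.app i) c m) _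
  choose T hT using hT
  let F : Cochain U M →ₗ[k] k :=
    ∑ i, ∑ j, ∑ a : i ⟶ j, T i j a ∘ₗ LinearMap.proj a ∘ₗ LinearMap.proj j ∘ₗ LinearMap.proj i
  have hFapply : ∀ c, F c = ∑ i, ∑ j, ∑ a : i ⟶ j, T i j a (c i j a) := fun c => by
    simp [F, LinearMap.sum_apply]
  have hFat : ∀ (i j : V) (a : i ⟶ j) f, F (cochainAt U M a f) = T i j a f := by
    intro i j a f
    rw [hFapply, Finset.sum_eq_single i, Finset.sum_eq_single j, Finset.sum_eq_single a]
    · simp [cochainAt]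
    · intro a' _ ha
      simp [cochainAt, Pi.single_eq_of_ne ha]
    · simp
    · intro j' _ hj
      refine Finset.sum_eq_zero fun a' _ => ?_
      simp [cochainAt, Pi.single_eq_of_ne hj]
    · simp
    · intro i' _ hi
      refine Finset.sum_eq_zero fun j' _ => Finset.sum_eq_zero fun a' _ => ?_
      simp [cochainAt, Pi.single_eq_of_ne hi]
    · simp
  -- The coboundary of the rank-one map `ξ ⊗ m` at `v` is matched, arrow by arrow, with that of `ξ ⊗
  -- e` in `P_v`; the form `tauValue g m` kills the latter because it lives on `Ext¹(U, P_v)`.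
  have hF : F ∘ₗ extDiff U M = 0 := by
    refine LinearMap.pi_ext' fun v => linearMap_ext_smulRight fun ξ m => ?_
    let e : (proj k v).obj v := projBasis Quiver.Path.nil
    let G : Cochain U (proj k v) →ₗ[k] k := tauValue g m ∘ₗ Submodule.mkQ _
    have hG : G (extDiff U (proj k v) (LinearMap.single k _ v (LinearMap.smulRight ξ e))) = 0 := by
      change tauValue g m (Submodule.Quotient.mk _) = 0
      rw [(Submodule.Quotient.mk_eq_zero _).2 (LinearMap.mem_range_self _ _), map_zero]
    change F (extDiff U M (LinearMap.single k _ v (LinearMap.smulRight ξ m))) = 0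
    rw [← hG, hFapply, ← sum_cochainAt (extDiff U (proj k v) _)]
    simp only [map_sum]
    refine Finset.sum_congr rfl fun i _ => Finset.sum_congr rfl fun j _ =>
      Finset.sum_congr rfl fun a _ => ?_
    simp only [extDiff, LinearMap.coe_mk, AddHom.coe_mk, map_sub, LinearMap.single_apply]
    congr 1
    · by_cases hi : i = v
      · subst hi
        rw [Pi.single_eq_same, Pi.single_eq_same]
        exact hT i j a (ξ ∘ₗ U.map a) m
      · rw [Pi.single_eq_of_ne hi, Pi.single_eq_of_ne hi, LinearMap.zero_comp,
          LinearMap.zero_comp, map_zero, map_zero, map_zero]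
    · by_cases hj : j = v
      · subst hj
        rw [Pi.single_eq_same, Pi.single_eq_same]
        have h1 : M.map a ∘ₗ LinearMap.smulRight ξ m = LinearMap.smulRight ξ (M.map a m) :=
          LinearMap.ext fun x => (M.map a).map_smul (ξ x) m
        have h2 : (proj k j).map a ∘ₗ LinearMap.smulRight ξ e =
            LinearMap.smulRight ξ (projBasis (Quiver.Path.nil.cons a)) :=
          LinearMap.ext fun x => (((proj k j).map a).map_smul (ξ x) e).trans
            (congrArg (fun y => ξ x • y) (proj_map_projBasis a Quiver.Path.nil))
        rw [h1, h2, hT, tauValue_map, ext1Post_arrowExt, projMap_projBasis]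
        rfl
      · rw [Pi.single_eq_of_ne hj, Pi.single_eq_of_ne hj, LinearMap.comp_zero,
          LinearMap.comp_zero, map_zero, map_zero, map_zero]
  refine ⟨Submodule.liftQ _ F ?_, fun i j a ξ m => ?_⟩
  · rw [LinearMap.range_le_ker_iff]
    exact hF
  · exact (hFat i j a _).trans (hT i j a ξ m)

theorem hom_tau_le_ext (U M : Rep k V) [U.FinDim] [M.FinDim] : hom M (tau U) ≤ ext U M := by
  choose Ψ hΨ using fun g : Hom M (tau U) => exists_dual_of_hom_tau g
  let L : homSpace M (tau U) →ₗ[k] Module.Dual k (Ext1 U M) :=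
    { toFun := fun g => Ψ ((homEquiv _ _).symm g)
      map_add' := fun g g' => ext1_linearMap_ext fun i j a ξ m => by
        rw [LinearMap.add_apply, hΨ, hΨ, hΨ]; rfl
      map_smul' := fun c g => ext1_linearMap_ext fun i j a ξ m => by
        rw [RingHom.id_apply, LinearMap.smul_apply, hΨ, hΨ]; rfl }
  have hL : Function.Injective L := by
    rw [injective_iff_map_eq_zero]
    intro g hg
    refine Subtype.ext (funext fun v => LinearMap.ext fun m => ?_)
    refine tauValue_eq_zero (g := (homEquiv _ _).symm g) (fun i j a ξ m => ?_) m
    rw [← hΨ]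
    exact LinearMap.congr_fun hg _
  have h := LinearMap.finrank_le_finrank_of_injective hL
  rwa [Subspace.dual_finrank_eq] at h

end Duality

/-! ### Extensions of stable modules -/

section StableExt

variable [Fintype V] {δ : V → ℕ}

theorem IsStable.not_isZero (hδ : IsMinimalImaginaryRoot δ) {E : Rep k V} (hE : E.IsStable δ) :
    ¬ E.IsZero := by
  have := hE.hasDimVector.finDim
  rw [isZero_iff_dimVector, hE.hasDimVector.dimVector_eq]
  exact hδ.1.1

variable [∀ i j : V, Finite (i ⟶ j)]

theorem hom_eq_ext_of_hasDimVector (hδ : IsMinimalImaginaryRoot δ) {M N : Rep k V}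
    (hM : M.HasDimVector δ) (hN : N.HasDimVector δ) : hom M N = ext M N := by
  have := hM.finDim
  have := hN.finDim
  have h1 := hom_sub_ext M N
  have h2 : eulerForm M.dimInt N.dimInt = 0 := by
    rw [hM.dimInt_eq, hN.dimInt_eq]; exact hδ.1.2
  omega

variable (hQ : IsTame V) (hδ : IsMinimalImaginaryRoot δ)
include hQ hδ

/-- An embedding in `P_v` would give `ext(E, E) = 0 = hom(E, E)`. Otherwise the kernel of a nonzero
map has negative defect, so its image `I` has positive defect; but `I` is a submodule of `P_v`, so
its defect is `-⟨I, δ⟩ = -hom(I, E) ≤ 0`. -/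
theorem IsStable.hom_proj_eq_zero [∀ i j : V, Finite (Quiver.Path i j)] {E : Rep k V}
    (hE : E.IsStable δ) (v : V) : hom E (proj k v) = 0 := by
  have := hE.hasDimVector.finDim
  by_contra h
  obtain ⟨f, i, x, hx⟩ := exists_hom_of_pos h
  by_cases hf : f.Inj
  · have h1 := ext_eq_zero_of_inj_proj hf E
    rw [← hom_eq_ext_of_hasDimVector hδ hE.hasDimVector hE.hasDimVector] at h1
    exact hom_self_ne_zero (hE.not_isZero hδ) h1
  · have h1 : defect δ f.ker.toRep < 0 := by
      refine hE.defect_neg _ (fun h0 => hf fun i => LinearMap.ker_eq_bot.1 (congrFun h0 i))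
        fun h0 => hx ?_
      have : x ∈ f.ker.carrier i := by rw [h0]; trivial
      exact this
    have h2 := defect_ker_add_range δ f
    have h3 := ext_eq_zero_of_inj_proj f.range.incl_inj E
    have h4 := hom_sub_ext f.range.toRep E
    rw [hE.hasDimVector.defect_eq E, hE.hasDimVector.dimInt_eq, hδ.1.2] at h2
    have h5 : defect δ f.range.toRep = -eulerForm f.range.toRep.dimInt E.dimInt := by
      rw [hE.hasDimVector.dimInt_eq]
      exact hδ.swap hQ _
    omega

/-- As `Hom(E, P_v) = 0`, the dimension at `v` is `-⟨δ, P_v⟩ = ⟨P_v, δ⟩ = δ v`. -/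
theorem IsStable.hasDimVector_tau [∀ i j : V, Finite (Quiver.Path i j)] {E : Rep k V}
    (hE : E.IsStable δ) : (tau E).HasDimVector δ := by
  have := hE.hasDimVector.finDim
  refine fun v => ⟨inferInstance, ?_⟩
  have h1 := dimInt_tau E v
  rw [hE.hom_proj_eq_zero hQ hδ, hE.hasDimVector.dimInt_eq, hδ.swap hQ, eulerForm_proj_left] at h1
  have h2 : (tau E).dimInt v = (Module.finrank k ((tau E).obj v) : ℤ) := rfl
  omega

/-- On `End E` the map `f ↦ τf` is injective, because `τ` preserves injectivity and `τE ≠ 0`. Two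
applications of duality, with `hom = ext` in dimension vector `δ`, bound `dim End(τE)` by `dim End
E`. So each nonzero endomorphism of `τE` is `τf` with `f` nonzero, hence injective. -/
theorem IsStable.isBrick_tau [∀ i j : V, Finite (Quiver.Path i j)] {E : Rep k V}
    (hE : E.IsStable δ) : (tau E).IsBrick := by
  have := hE.hasDimVector.finDim
  have hτ := hE.hasDimVector_tau hQ hδ
  let L : homSpace E E →ₗ[k] homSpace (tau E) (tau E) :=
    { toFun := fun f => homEquiv _ _ (tauMap ((homEquiv _ _).symm f))
      map_add' := fun f g => Subtype.ext <| funext fun v =>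
        LinearMap.ext fun (φ : Module.Dual k (Ext1 E (proj k v))) => LinearMap.ext fun z =>
          (congrArg φ (ext1Pre_add (φ := (homEquiv _ _).symm (f + g))
            (φ₁ := (homEquiv _ _).symm f) (φ₂ := (homEquiv _ _).symm g) (fun _ => rfl) _ z)).trans
              (map_add φ _ _)
      map_smul' := fun r f => Subtype.ext <| funext fun v =>
        LinearMap.ext fun (φ : Module.Dual k (Ext1 E (proj k v))) => LinearMap.ext fun z =>
          (congrArg φ (ext1Pre_smul (φ := (homEquiv _ _).symm (r • f))
            (φ₁ := (homEquiv _ _).symm f) (fun _ => rfl) _ z)).trans (map_smul φ _ _) }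
  have hne : ¬ (tau E).IsZero := by
    rw [isZero_iff_dimVector, hτ.dimVector_eq]
    exact hδ.1.1
  have hL : Function.Injective L := by
    rw [injective_iff_map_eq_zero]
    intro f hf
    by_contra hf0
    have h1 := tauMap_inj (hE.isBrick ((homEquiv _ _).symm f)
      ((Hom.neZero_iff _).2 (by simpa using hf0)))
    simp only [IsZero, not_forall, not_subsingleton_iff_nontrivial] at hne
    obtain ⟨v, hv⟩ := hne
    obtain ⟨x, hx⟩ := exists_ne (0 : (tau E).obj v)
    refine hx (h1 v (Eq.trans ?_ (map_zero _).symm))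
    exact LinearMap.congr_fun (congrFun (congrArg Subtype.val hf) v) x
  have h1 : hom (tau E) (tau E) ≤ hom E E :=
    calc hom (tau E) (tau E) ≤ ext E (tau E) := hom_tau_le_ext E (tau E)
      _ = hom E (tau E) := (hom_eq_ext_of_hasDimVector hδ hE.hasDimVector hτ).symm
      _ ≤ ext E E := hom_tau_le_ext E E
      _ = hom E E := (hom_eq_ext_of_hasDimVector hδ hE.hasDimVector hE.hasDimVector).symm
  have h2 : hom E E = hom (tau E) (tau E) :=
    le_antisymm (LinearMap.finrank_le_finrank_of_injective hL) h1
  have hs := (LinearMap.injective_iff_surjective_of_finrank_eq_finrank h2).1 hL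
  intro g hg
  obtain ⟨f, hf⟩ := hs (homEquiv _ _ g)
  have hf0 : f ≠ 0 := by
    rintro rfl
    rw [map_zero] at hf
    exact g.neZero_iff.1 hg hf.symm
  have h3 := tauMap_inj (hE.isBrick ((homEquiv _ _).symm f)
    ((Hom.neZero_iff _).2 (by simpa using hf0)))
  have h4 : tauMap ((homEquiv _ _).symm f) = g := (homEquiv _ _).injective hf
  rwa [h4] at h3

/-- A stable module has no extensions by proper quotients of stable modules. -/
theorem IsStable.ext_eq_zero {E E' W : Rep k V} (hE : E.IsStable δ) (hE' : E'.IsStable δ)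
    [W.FinDim] {p : Hom E W} (hp : p.Surj) (hW : W.dimVector ≠ δ) : ext E' W = 0 := by
  have := hE.hasDimVector.finDim
  have := hE'.hasDimVector.finDim
  have := hQ.1.finite_path
  by_contra h
  obtain ⟨g, i, y, hy⟩ := exists_hom_tau h
  obtain ⟨x, rfl⟩ := hp i y
  -- The kernel of `f` is nonzero since `W` is smaller than `E`, and proper since `f` is nonzero.
  -- Stability makes its defect negative, so the image has positive defect.
  let f : Hom E (tau E') := g.comp p
  have hker : f.ker.carrier ≠ ⊥ := by
    intro h0
    have hpi : p.Inj := fun i x y hxy =>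
      LinearMap.ker_eq_bot.1 (congrFun h0 i) (congrArg (g.app i) hxy)
    refine hW (le_antisymm ?_ ?_) <;> rw [← hE.hasDimVector.dimVector_eq]
    · exact dimVector_le_of_surj hp
    · exact dimVector_le_of_inj hpi
  have h1 : defect δ f.ker.toRep < 0 := by
    refine hE.defect_neg _ hker fun h0 => hy ?_
    have : x ∈ f.ker.carrier i := by rw [h0]; trivial
    exact this
  have h2 := defect_ker_add_range δ f
  rw [hE.hasDimVector.defect_eq E, hE.hasDimVector.dimInt_eq, hδ.1.2] at h2
  have hτ := hE'.hasDimVector_tau hQ hδ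
  have h3 := hom_sub_ext (tau E') f.range.toRep
  rw [← hτ.defect_eq] at h3
  -- The positive defect of the image yields a nonzero map from `τE'` to it. Since `τE'` is a brick,
  -- this map is injective, so the image is as large as `E` and the kernel of `f` vanishes.
  obtain ⟨t, j, z, hz⟩ := exists_hom_of_pos (M := tau E') (N := f.range.toRep) (by omega)
  have h4 : (f.range.incl.comp t).Inj := hE'.isBrick_tau hQ hδ _
    ⟨j, z, fun h0 => hz (f.range.incl_inj j (h0.trans (map_zero _).symm))⟩
  have h5 : t.Inj := fun i x y hxy => h4 i (congrArg (f.range.incl.app i) hxy)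
  have h6 := dimVector_le_of_inj h5
  have h7 := f.dimInt_ker_add_range
  refine hker (f.ker.isZero_iff.1 (isZero_iff_dimVector.2 (funext fun i => ?_)))
  have h8 := congrFun h7 i
  have h9 : E.dimVector i ≤ f.range.toRep.dimVector i := by
    rw [hE.hasDimVector.dimVector_eq, ← hτ.dimVector_eq]
    exact h6 i
  have h10 : (f.ker.toRep.dimVector i : ℤ) + f.range.toRep.dimVector i = E.dimVector i := h8
  change f.ker.toRep.dimVector i = 0
  omega

end StableExt

end Rep

end TameQuiver

namespace TameQuiver

namespace Rep

variable {k : Type u} [Field k] {V : Type} [Quiver.{0} V]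

/-! ### Counting surjections -/

section Surjections

/-- The surjective homomorphisms. -/
def SurjHom (M N : Rep k V) : Type u := {f : Hom M N // f.Surj}

theorem Hom.app_injective (M N : Rep k V) :
    Function.Injective (Hom.app : Hom M N → ∀ i, M.obj i →ₗ[k] N.obj i) :=
  fun _ _ h => Hom.ext h

theorem Sub.carrier_injective (M : Rep k V) :
    Function.Injective (Sub.carrier : Sub M → ∀ i, Submodule k (M.obj i)) := by
  rintro ⟨U, _⟩ ⟨W, _⟩ h
  cases h
  rfl

/-- The module as a submodule of itself. -/
def Sub.top (M : Rep k V) : Sub M := ⟨fun _ => ⊤, fun _ _ _ => trivial⟩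

/-- A homomorphism is a surjection to its image. -/
noncomputable def homEquivSigma (M N : Rep k V) : Hom M N ≃ Σ U : Sub N, SurjHom M U.toRep where
  toFun f := ⟨f.range, f.rangeRestrict, f.rangeRestrict_surj⟩
  invFun x := x.1.incl.comp x.2.1
  left_inv _ := rfl
  right_inv := by
    rintro ⟨U, f, hf⟩
    have h : (U.incl.comp f).range = U := by
      refine Sub.carrier_injective N (funext fun i => Submodule.ext fun x => ⟨?_, fun hx => ?_⟩)
      · rintro ⟨y, rfl⟩
        exact (f.app i y).2
      · obtain ⟨y, hy⟩ := hf i ⟨x, hx⟩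
        exact ⟨y, congrArg (U.incl.app i) hy⟩
    refine Sigma.ext h ?_
    -- The image is generalized to a variable `U'`, so that the equality with `U` can be eliminated
    -- in the dependent type.
    have key : ∀ (U' : Sub N) (g : SurjHom M U'.toRep), U' = U →
        (∀ i x, U'.incl.app i (g.1.app i x) = U.incl.app i (f.app i x)) →
          HEq g (⟨f, hf⟩ : SurjHom M U.toRep) := by
      rintro U' g rfl hg
      refine heq_of_eq (Subtype.ext (Hom.ext (funext fun i => LinearMap.ext fun x => ?_)))
      exact Subtype.ext (hg i x)
    exact key _ _ h fun _ _ => rfl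

theorem card_surjHom_top (M N : Rep k V) :
    Nat.card (SurjHom M (Sub.top N).toRep) = Nat.card (SurjHom M N) := by
  refine Nat.card_congr
    { toFun := fun f => ⟨(Sub.top N).incl.comp f.1, fun i x => ?_⟩
      invFun := fun f => ⟨f.1.codRestrict (Sub.top N) fun _ _ => trivial, fun i x => ?_⟩
      left_inv := fun _ => rfl
      right_inv := fun _ => rfl }
  · obtain ⟨y, hy⟩ := f.2 i ⟨x, trivial⟩
    exact ⟨y, congrArg ((Sub.top N).incl.app i) hy⟩
  · obtain ⟨y, hy⟩ := f.2 i x.1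
    exact ⟨y, Subtype.ext hy⟩

theorem card_hom [Finite V] (M N : Rep k V) [M.FinDim] [N.FinDim] :
    Nat.card (Hom M N) = Nat.card k ^ hom M N := by
  rw [Nat.card_congr (homEquiv M N), hom, Module.natCard_eq_pow_finrank (K := k)]

variable [Finite k]

instance (M : Rep k V) [M.FinDim] (i : V) : Finite (M.obj i) := Module.finite_of_finite k

instance (M N : Rep k V) [Finite V] [M.FinDim] [N.FinDim] : Finite (Hom M N) := by
  have : ∀ i, Finite (M.obj i →ₗ[k] N.obj i) := fun i => Module.finite_of_finite k
  exact Finite.of_injective _ (Hom.app_injective M N)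

instance (M N : Rep k V) [Finite V] [M.FinDim] [N.FinDim] : Finite (SurjHom M N) :=
  inferInstanceAs (Finite {f : Hom M N // f.Surj})

instance (M : Rep k V) [Finite V] [M.FinDim] : Finite (Sub M) := by
  have : ∀ i, Finite (Submodule k (M.obj i)) := fun i =>
    Finite.of_injective _ (SetLike.coe_injective (A := Submodule k (M.obj i)))
  exact Finite.of_injective _ (Sub.carrier_injective M)

variable [Fintype V]

theorem card_hom_eq_sum (M N : Rep k V) [M.FinDim] [N.FinDim] [Fintype (Sub N)] :
    Nat.card (Hom M N) = ∑ U : Sub N, Nat.card (SurjHom M U.toRep) := by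
  rw [Nat.card_congr (homEquivSigma M N), Nat.card_sigma]

variable [∀ i j : V, Finite (i ⟶ j)]

/-- Stable modules of dimension vector `δ` have the same number of surjections to smaller
modules. -/
theorem IsStable.card_surjHom_eq (hQ : IsTame V) {δ : V → ℕ} (hδ : IsMinimalImaginaryRoot δ)
    {E E' W : Rep k V} (hE : E.IsStable δ) (hE' : E'.IsStable δ) [W.FinDim]
    (hle : W.dimVector ≤ δ) (hne : W.dimVector ≠ δ) :
    Nat.card (SurjHom E W) = Nat.card (SurjHom E' W) := by
  classical
  have := hE.hasDimVector.finDim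
  have := hE'.hasDimVector.finDim
  obtain ⟨n, hn⟩ : ∃ n, W.totalDim = n := ⟨_, rfl⟩
  induction n using Nat.strong_induction_on generalizing W with
  | _ n ih =>
    -- If neither module surjects to `W`, both counts are zero. If one does, `Ext¹` to `W` vanishes
    -- for both, so both spaces of homomorphisms have dimension `⟨δ, dim W⟩`.
    by_cases hemp : IsEmpty (SurjHom E W) ∧ IsEmpty (SurjHom E' W)
    · have := hemp.1
      have := hemp.2
      rw [Nat.card_of_isEmpty, Nat.card_of_isEmpty]
    have hext : ext E W = 0 ∧ ext E' W = 0 := by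
      rw [not_and_or, not_isEmpty_iff, not_isEmpty_iff] at hemp
      rcases hemp with ⟨⟨p, hp⟩⟩ | ⟨⟨p, hp⟩⟩
      · exact ⟨hE.ext_eq_zero hQ hδ hE hp hne, hE.ext_eq_zero hQ hδ hE' hp hne⟩
      · exact ⟨hE'.ext_eq_zero hQ hδ hE hp hne, hE'.ext_eq_zero hQ hδ hE' hp hne⟩
    have hhom : hom E W = hom E' W := by
      have h1 := hom_sub_ext E W
      have h2 := hom_sub_ext E' W
      rw [hE.hasDimVector.dimInt_eq] at h1
      rw [hE'.hasDimVector.dimInt_eq] at h2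
      omega
    have := Fintype.ofFinite (Sub W)
    have hsum : ∑ U : Sub W, Nat.card (SurjHom E U.toRep) =
        ∑ U : Sub W, Nat.card (SurjHom E' U.toRep) := by
      rw [← card_hom_eq_sum, ← card_hom_eq_sum, card_hom, card_hom, hhom]
    -- The term of `W` itself is split off; proper submodules of `W` fall under the induction
    -- hypothesis.
    rw [← Finset.add_sum_erase _ _ (Finset.mem_univ (Sub.top W)),
      ← Finset.add_sum_erase _ _ (Finset.mem_univ (Sub.top W)),
      card_surjHom_top, card_surjHom_top] at hsum
    have hrest : ∑ U ∈ Finset.univ.erase (Sub.top W), Nat.card (SurjHom E U.toRep) =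
        ∑ U ∈ Finset.univ.erase (Sub.top W), Nat.card (SurjHom E' U.toRep) := by
      refine Finset.sum_congr rfl fun U hU => ?_
      have hU' : U.toRep.dimVector ≠ W.dimVector := fun h =>
        (Finset.mem_erase.1 hU).1 (Sub.carrier_injective W (U.eq_top_of_dimVector h))
      refine ih U.toRep.totalDim ?_ (U.dimVector_le.trans hle) (fun h => ?_) rfl
      · rw [← hn]
        exact totalDim_lt U.dimVector_le hU'
      · exact hne (le_antisymm hle (h ▸ U.dimVector_le))
    omega

end Surjections

/-! ### Quiver Grassmannians and surjections -/

section Grassmannian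

theorem card_linearEquiv_eq {X Y Z : Type*} [AddCommGroup X] [Module k X] [AddCommGroup Y]
    [Module k Y] [AddCommGroup Z] [Module k Z] (e : X ≃ₗ[k] Y) :
    Nat.card (X ≃ₗ[k] Z) = Nat.card (Y ≃ₗ[k] Z) :=
  Nat.card_congr
    { toFun := fun f => e.symm.trans f
      invFun := fun f => e.trans f
      left_inv := fun f => LinearEquiv.ext fun x => by simp
      right_inv := fun f => LinearEquiv.ext fun x => by simp }

/-- The number of surjections with a given kernel. -/
theorem card_surjective_ker_eq {X Z : Type*} [AddCommGroup X] [Module k X] [AddCommGroup Z]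
    [Module k Z] [Module.Finite k X] [Module.Finite k Z] (K : Submodule k X)
    (h : Module.finrank k X = Module.finrank k K + Module.finrank k Z) :
    Nat.card {f : X →ₗ[k] Z // Function.Surjective f ∧ LinearMap.ker f = K} =
      Nat.card (Z ≃ₗ[k] Z) := by
  have h1 := Submodule.finrank_quotient_add_finrank K
  have h2 : Module.finrank k (X ⧸ K) = Module.finrank k Z := by omega
  rw [← card_linearEquiv_eq (LinearEquiv.ofFinrankEq (X ⧸ K) Z h2)]
  have hker : ∀ e : (X ⧸ K) ≃ₗ[k] Z, LinearMap.ker (e.toLinearMap ∘ₗ K.mkQ) = K := fun e => by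
    rw [LinearEquiv.ker_comp, Submodule.ker_mkQ]
  refine (Nat.card_congr (Equiv.ofBijective
    (fun e : (X ⧸ K) ≃ₗ[k] Z => ⟨e.toLinearMap ∘ₗ K.mkQ,
      e.surjective.comp K.mkQ_surjective, hker e⟩) ⟨fun e e' h => ?_, ?_⟩)).symm
  · refine LinearEquiv.toLinearMap_injective (Submodule.linearMap_qext _ ?_)
    exact congrArg Subtype.val h
  · rintro ⟨f, hf, rfl⟩
    exact ⟨f.quotKerEquivOfSurjective hf, Subtype.ext (LinearMap.ext fun x => rfl)⟩

/-- The module structures on the coordinate spaces of dimension vector `w`. -/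
abbrev Structures (k : Type u) [Field k] (V : Type) [Quiver.{0} V] (w : V → ℕ) : Type u :=
  ∀ i j : V, (i ⟶ j) → ((Fin (w j) → k) →ₗ[k] (Fin (w i) → k))

/-- The module given by linear maps of the coordinate spaces. -/
def ofStructure {w : V → ℕ} (ρ : Structures k V w) : Rep k V where
  obj i := Fin (w i) → k
  map {i j} a := ρ i j a

instance {w : V → ℕ} (ρ : Structures k V w) : (ofStructure ρ).FinDim :=
  ⟨fun i => inferInstanceAs (Module.Finite k (Fin (w i) → k))⟩

theorem dimVector_ofStructure {w : V → ℕ} (ρ : Structures k V w) :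
    (ofStructure ρ).dimVector = w := by
  funext i
  change Module.finrank k (Fin (w i) → k) = w i
  simp

theorem isEmpty_gr_of_not_le {M : Rep k V} [M.FinDim] {e : V → ℕ} (h : ¬ e ≤ M.dimVector) :
    IsEmpty (M.Gr e) :=
  ⟨fun U => h (by rw [← U.2.dimVector_eq]; exact U.1.dimVector_le)⟩

theorem card_gr_zero (M : Rep k V) : Nat.card (M.Gr 0) = 1 := by
  have h0 : ∀ U : Sub M, U.toRep.HasDimVector 0 ↔ U.carrier = ⊥ := by
    intro U
    refine ⟨fun h => U.isZero_iff.1 ?_, fun h i => ?_⟩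
    · have := h.finDim
      exact isZero_iff_dimVector.2 h.dimVector_eq
    · change Module.Finite k (U.carrier i) ∧ Module.finrank k (U.carrier i) = 0
      rw [h]
      exact ⟨inferInstanceAs (Module.Finite k (⊥ : Submodule k (M.obj i))), finrank_bot k _⟩
  rw [Nat.card_eq_one_iff_unique]
  refine ⟨⟨fun U W => Subtype.ext (Sub.carrier_injective M ?_)⟩, ⟨⟨⟨fun _ => ⊥, ?_⟩, ?_⟩⟩⟩
  · rw [(h0 U.1).1 U.2, (h0 W.1).1 W.2]
  · intro i j a x hx
    rw [Submodule.mem_bot] at hx ⊢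
    rw [hx, map_zero]
  · exact (h0 _).2 rfl

variable [Fintype V] [Finite k]

instance (M : Rep k V) [M.FinDim] (e : V → ℕ) : Finite (M.Gr e) :=
  inferInstanceAs (Finite {U : Sub M // U.toRep.HasDimVector e})

instance [∀ i j : V, Finite (i ⟶ j)] (w : V → ℕ) : Finite (Structures k V w) := by
  have : ∀ i j : V, Finite ((Fin (w j) → k) →ₗ[k] (Fin (w i) → k)) :=
    fun i j => Module.finite_of_finite k
  infer_instance

/-- Submodules of dimension vector `e` are counted by surjections to modules of complementary
dimension vector. -/
theorem card_gr_mul (E : Rep k V) [E.FinDim] (e w : V → ℕ) (h : E.dimVector = e + w)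
    [Fintype (Structures k V w)] :
    Nat.card (E.Gr e) * ∏ i, Nat.card ((Fin (w i) → k) ≃ₗ[k] (Fin (w i) → k)) =
      ∑ ρ : Structures k V w, Nat.card (SurjHom E (ofStructure ρ)) := by
  have hd : ∀ i, Module.finrank k (E.obj i) = e i + w i := fun i => congrFun h i
  -- Both sides count families of linear surjections `E_i → k^{w_i}` whose kernels form a submodule.
  -- Such a family is compatible with exactly one module structure on the target, and each submodule
  -- is the kernel of `∏ |GL_{w_i}|` families.
  let fib (U : E.Gr e) (i : V) : Type u := {f : E.obj i →ₗ[k] (Fin (w i) → k) //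
    Function.Surjective f ∧ LinearMap.ker f = U.1.carrier i}
  have hmaps : ∀ i, Finite (E.obj i →ₗ[k] (Fin (w i) → k)) := fun i => Module.finite_of_finite k
  have hfin : ∀ U i, Finite (fib U i) := fun U i => inferInstanceAs (Finite (Subtype _))
  have hfib : ∀ U i, Nat.card (fib U i) = Nat.card ((Fin (w i) → k) ≃ₗ[k] (Fin (w i) → k)) := by
    intro U i
    refine card_surjective_ker_eq _ ?_
    have h1 : Module.finrank k (U.1.carrier i) = e i := (U.2 i).2
    rw [hd, h1, Module.finrank_fin_fun]
  let F : (Σ ρ : Structures k V w, SurjHom E (ofStructure ρ)) →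
      ∀ i, E.obj i →ₗ[k] (Fin (w i) → k) := fun x => x.2.1.app
  let G : (Σ U : E.Gr e, ∀ i, fib U i) → ∀ i, E.obj i →ₗ[k] (Fin (w i) → k) :=
    fun x i => (x.2 i).1
  have hF : Function.Injective F := by
    rintro ⟨ρ, f, hf⟩ ⟨ρ', f', hf'⟩ hff
    have h1 : ∀ i, f.app i = f'.app i := fun i => congrFun hff i
    obtain rfl : ρ = ρ' := by
      funext i j a
      refine LinearMap.ext fun y => ?_
      obtain ⟨x, rfl⟩ := hf j y
      have h2 := f.comm_apply a x
      have h3 := f'.comm_apply a x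
      rw [← h1, ← h1] at h3
      exact h2.symm.trans h3
    obtain rfl : f = f' := Hom.ext (funext h1)
    rfl
  have hG : Function.Injective G := by
    rintro ⟨U, f⟩ ⟨U', f'⟩ hff
    have h1 : ∀ i, (f i).1 = (f' i).1 := fun i => congrFun hff i
    obtain rfl : U = U' := by
      refine Subtype.ext (Sub.carrier_injective E (funext fun i => ?_))
      rw [← (f i).2.2, ← (f' i).2.2, h1]
    obtain rfl : f = f' := funext fun i => Subtype.ext (h1 i)
    rfl
  have hFG : Set.range F = Set.range G := by
    ext g
    constructor
    · rintro ⟨⟨ρ, f, hf⟩, rfl⟩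
      refine ⟨⟨⟨f.ker, fun i => ⟨inferInstance, ?_⟩⟩, fun i => ⟨f.app i, hf i, rfl⟩⟩, rfl⟩
      have h1 := LinearMap.finrank_range_add_finrank_ker (f.app i)
      rw [LinearMap.range_eq_top.2 (hf i), finrank_top, hd] at h1
      have h2 : Module.finrank k ((ofStructure ρ).obj i) = w i :=
        congrFun (dimVector_ofStructure ρ) i
      change Module.finrank k (LinearMap.ker (f.app i)) = e i
      omega
    · rintro ⟨⟨U, f⟩, rfl⟩
      have h1 : ∀ (i j : V) (a : i ⟶ j), ∃ r : (Fin (w j) → k) →ₗ[k] (Fin (w i) → k),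
          r ∘ₗ (f j).1 = (f i).1 ∘ₗ E.map a := by
        intro i j a
        refine exists_comp_eq_of_ker_le _ _ fun x hx => ?_
        rw [(f j).2.2] at hx
        have h2 := U.1.map_mem a x hx
        rw [← (f i).2.2] at h2
        exact h2
      choose ρ hρ using h1
      exact ⟨⟨ρ, ⟨fun i => (f i).1, fun {i j} a => (hρ i j a).symm⟩, fun i => (f i).2.1⟩, rfl⟩
  have h1 := Nat.card_range_of_injective hF
  rw [hFG, Nat.card_range_of_injective hG] at h1
  have := Fintype.ofFinite (E.Gr e)
  rw [Nat.card_sigma, Nat.card_sigma] at h1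
  rw [← h1]
  simp only [Nat.card_pi, hfib, Finset.sum_const, Finset.card_univ, smul_eq_mul,
    Nat.card_eq_fintype_card (α := E.Gr e)]

theorem IsStable.card_gr_eq [∀ i j : V, Finite (i ⟶ j)] (hQ : IsTame V) {δ : V → ℕ} (hδ : IsMinimalImaginaryRoot δ)
    {E E' : Rep k V} (hE : E.IsStable δ) (hE' : E'.IsStable δ) (e : V → ℕ) :
    Nat.card (E.Gr e) = Nat.card (E'.Gr e) := by
  have := hE.hasDimVector.finDim
  have := hE'.hasDimVector.finDim
  by_cases he : e ≤ δ
  · obtain ⟨w, rfl⟩ := exists_add_of_le he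
    -- For `e = 0` the surjections would go to modules of dimension vector `δ`, where the comparison
    -- is not available; but the zero submodule is the only one.
    by_cases h0 : e = 0
    · subst h0
      rw [card_gr_zero, card_gr_zero]
    · have := Fintype.ofFinite (Structures k V w)
      have h1 := card_gr_mul E e w hE.hasDimVector.dimVector_eq
      have h2 := card_gr_mul E' e w hE'.hasDimVector.dimVector_eq
      have h3 : ∑ ρ : Structures k V w, Nat.card (SurjHom E (ofStructure ρ)) =
          ∑ ρ : Structures k V w, Nat.card (SurjHom E' (ofStructure ρ)) := by
        refine Finset.sum_congr rfl fun ρ _ => hE.card_surjHom_eq hQ hδ hE' ?_ ?_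
        · rw [dimVector_ofStructure]
          exact le_add_self
        · rw [dimVector_ofStructure]
          exact fun h => h0 (add_eq_right.1 h.symm)
      rw [← h2, ← h1] at h3
      refine Nat.eq_of_mul_eq_mul_right (Finset.prod_pos fun i _ => ?_) h3
      have : Finite ((Fin (w i) → k) ≃ₗ[k] (Fin (w i) → k)) :=
        Finite.of_injective _ DFunLike.coe_injective
      exact Nat.card_pos
  · have := isEmpty_gr_of_not_le (M := E) (e := e) (by rwa [hE.hasDimVector.dimVector_eq])
    have := isEmpty_gr_of_not_le (M := E') (e := e) (by rwa [hE'.hasDimVector.dimVector_eq])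
    rw [Nat.card_of_isEmpty, Nat.card_of_isEmpty]

end Grassmannian

end Rep

/-! ### The quantum Caldero–Chapoton map and the main theorem. -/

theorem quantumCC_congr {V : Type} [Quiver.{0} V] [Fintype V] [DecidableEq V] {C : Finset V}
    {R : Type*} [CommRing R] (h : Rˣ) (Λ : Matrix V V ℤ) {k : Type u} [Field k]
    {M N : Rep k (Principal C)} (hd : M.dimVector = N.dimVector)
    (hGr : ∀ e, Nat.card (M.Gr e) = Nat.card (N.Gr e)) : quantumCC h Λ M = quantumCC h Λ N := by
  simp only [quantumCC, hd, hGr]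

end TameQuiver

theorem mainTheorem10 {V : Type} [Fintype V] [DecidableEq V] [Quiver.{0} V]
    [∀ i j : V, Finite (i ⟶ j)] (hV : TameQuiver.IsAcyclic V) (C : Finset V)
    (hQ : TameQuiver.IsTame (TameQuiver.Principal C))
    {k : Type u} [Field k] [Finite k]
    (δ : TameQuiver.Principal C → ℕ) (hδ : TameQuiver.IsMinimalImaginaryRoot δ)
    (E E' : TameQuiver.Rep k (TameQuiver.Principal C))
    (hE : E.IsRegularSimple) (hE' : E'.IsRegularSimple)
    (hdim : E.HasDimVector δ) (hdim' : E'.HasDimVector δ) :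
    (∀ e : TameQuiver.Principal C → ℕ, Nat.card (E.Gr e) = Nat.card (E'.Gr e)) ∧
    ∀ Λ : Matrix V V ℤ, Λᵀ = -Λ →
      Λ * (-TameQuiver.bTilde C) = TameQuiver.iTilde C →
      TameQuiver.quantumCC (TameQuiver.sqrtUnit (Nat.card k) Nat.card_pos.ne') Λ E =
        TameQuiver.quantumCC (TameQuiver.sqrtUnit (Nat.card k) Nat.card_pos.ne') Λ E' ∧
      TameQuiver.quantumCC TameQuiver.formalUnit Λ E =
        TameQuiver.quantumCC TameQuiver.formalUnit Λ E' := by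
  have : ∀ i j : TameQuiver.Principal C, Finite (i ⟶ j) := hQ.2.1
  have hGr : ∀ e, Nat.card (E.Gr e) = Nat.card (E'.Gr e) :=
    (hE.isStable hQ hδ hdim).card_gr_eq hQ hδ (hE'.isStable hQ hδ hdim')
  have hd : E.dimVector = E'.dimVector := hdim.dimVector_eq.trans hdim'.dimVector_eq.symm
  exact ⟨hGr, fun Λ _ _ => ⟨TameQuiver.quantumCC_congr _ Λ hd hGr,
    TameQuiver.quantumCC_congr _ Λ hd hGr⟩⟩
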